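/- Let a finite group $G$ act linearly on $\mathbb{R}^n$, and for a polynomial $p$ in $X=(X_1,\dots,X_n)$ and $\sigma\in G$ put $p^\sigma(x)=p(\sigma^{-1}x)$. This makes $\mathbb{R}[X]$ and $\mathbb{C}[X]$ representations of $G$; $p\in\mathbb{R}[X]$ is called $G$-invariant if $p^\sigma=p$ for all $\sigma\in G$, and $\rho^G(p)=\frac1{|G|}\sum_{\sigma\in G}p^\sigma$ is the Reynolds operator. Let $$\mathbb{C}[X]=\bigoplus_{i=1}^h\bigoplus_{j\in J_i}W_{ij}$$ be any decomposition into irreducible subrepresentations such that $W_{ij}\cong W_{i'j'}$ if and only if $i=i'$ (the index sets $J_i$ are nonempty and may be infinite). For each $i$ fix an element $j_1\in J_i$, a nonzero vector $s^i\in W_{ij_1}$, and $G$-isomorphisms $\phi^i_j:W_{ij_1}\to W_{ij}$ ($j\in J_i$), and let $\mathcal{S}^i_{\mathbb{C}}=\{\phi^i_j(s^i): j\in J_i\}\subseteq\mathbb{C}[X]$. Let $\mathcal{S}^i\subseteq\mathbb{R}[X]$ be the set of the (coefficientwise) real and imaginary parts of the elements of $\mathcal{S}^i_{\mathbb{C}}$;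 if these elements have real coefficients, then $\mathcal{S}^i$ is $\mathcal{S}^i_{\mathbb{C}}$ itself, up to the zero polynomial. Let $f,g_1,\dots,g_m\in\mathbb{R}[X]$ be $G$-invariant and let $K=\{x\in\mathbb{R}^n: g_1(x)\ge0,\dots,g_m(x)\ge0\}$. Assume that $K$ is compact and that there is a polynomial $u=u_0+\sum_{j=1}^m u_jg_j$, with $u_0,\dots,u_m\in\mathbb{R}[X]$ sums of squares of polynomials, such that $\{x\in\mathbb{R}^n:u(x)\ge0\}$ is compact. If $f(x)>0$ for all $x\in K$, then $f$ can be written in the form $$f=\rho^G\Big(\sum_{i=1}^h q_0^i+\sum_{j=1}^m g_j\sum_{i=1}^h q_j^i\Big),$$ where for $1\le i\le h$ and $0\le j\le m$ the polynomial $q_j^i$ is a finite sum of squares of polynomials in the real linear span of $\mathcal{S}^i$. -/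

import Mathlib

open MvPolynomial

/-- Linear substitution: `linSubst A p` is the polynomial `x ↦ p (A x)`. -/
noncomputable def linSubst {n : ℕ} {k : Type*} [CommRing k] (A : Matrix (Fin n) (Fin n) k) :
    MvPolynomial (Fin n) k →ₐ[k] MvPolynomial (Fin n) k :=
  aeval fun i => ∑ j, C (A i j) * X j

theorem linSubst_one {n : ℕ} {k : Type*} [CommRing k] :
    linSubst (1 : Matrix (Fin n) (Fin n) k) = AlgHom.id k _ := by
  classical
  refine MvPolynomial.algHom_ext fun i => ?_
  simp [linSubst, Matrix.one_apply]

theorem linSubst_mul {n : ℕ} {k : Type*} [CommRing k] (A B : Matrix (Fin n) (Fin n) k) :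
    linSubst (A * B) = (linSubst B).comp (linSubst A) := by
  refine MvPolynomial.algHom_ext fun i => ?_
  simp only [linSubst, aeval_X, AlgHom.comp_apply, map_sum, map_mul, Matrix.mul_apply,
    Finset.sum_mul, Finset.mul_sum, algHom_C, MvPolynomial.algebraMap_eq]
  rw [Finset.sum_comm]
  simp only [mul_assoc]

theorem eval_linSubst {n : ℕ} {k : Type*} [CommRing k] (A : Matrix (Fin n) (Fin n) k)
    (p : MvPolynomial (Fin n) k) (x : Fin n → k) :
    eval x (linSubst A p) = eval (A.mulVec x) p := by
  have h : (aeval x : MvPolynomial (Fin n) k →ₐ[k] k).comp (linSubst A) =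
      aeval (A.mulVec x) := by
    refine MvPolynomial.algHom_ext fun i => ?_
    simp [linSubst, Matrix.mulVec, dotProduct]
  have h' := DFunLike.congr_fun h p
  simpa [AlgHom.comp_apply, MvPolynomial.coe_aeval_eq_eval] using h'

/-- The action `p ↦ p^σ`, `p^σ (x) = p (σ⁻¹ x)`, of a group acting linearly on `ℝⁿ`, on the
polynomials with coefficients in `k` (used for `k = ℝ` and `k = ℂ`). -/
noncomputable def polyRep {G : Type*} [Group G] {n : ℕ} (k : Type*) [CommRing k] [Algebra ℝ k]
    (ρ : Representation ℝ G (Fin n → ℝ)) : Representation k G (MvPolynomial (Fin n) k) where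
  toFun σ := (linSubst ((LinearMap.toMatrix' (ρ σ⁻¹)).map (algebraMap ℝ k))).toLinearMap
  map_one' := by
    classical
    have h : LinearMap.toMatrix' (1 : (Fin n → ℝ) →ₗ[ℝ] (Fin n → ℝ)) = 1 :=
      LinearMap.toMatrix'_one
    rw [inv_one, map_one, h, Matrix.map_one _ (map_zero _) (map_one _), linSubst_one]
    rfl
  map_mul' σ τ := by
    rw [mul_inv_rev, map_mul, LinearMap.toMatrix'_mul, Matrix.map_mul, linSubst_mul]
    rfl

theorem eval_polyRep {G : Type*} [Group G] {n : ℕ} (ρ : Representation ℝ G (Fin n → ℝ)) (σ : G)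
    (p : MvPolynomial (Fin n) ℝ) (x : Fin n → ℝ) :
    eval x (polyRep ℝ ρ σ p) = eval (ρ σ⁻¹ x) p := by
  have h : (LinearMap.toMatrix' (ρ σ⁻¹)).mulVec x = ρ σ⁻¹ x :=
    LinearMap.toMatrix'_mulVec _ _
  simp [polyRep, eval_linSubst, h]

/-- `p` is `G`-invariant: `p^σ = p` for all `σ`. -/
def IsInvariantPoly {G : Type*} [Group G] {n : ℕ} (ρ : Representation ℝ G (Fin n → ℝ))
    (p : MvPolynomial (Fin n) ℝ) : Prop :=
  ∀ σ : G, polyRep ℝ ρ σ p = p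

/-- The Reynolds operator `p ↦ (1 / |G|) ∑ σ, p^σ`. -/
noncomputable def reynolds {G : Type*} [Group G] [Fintype G] {n : ℕ}
    (ρ : Representation ℝ G (Fin n → ℝ)) (p : MvPolynomial (Fin n) ℝ) :
    MvPolynomial (Fin n) ℝ :=
  (Fintype.card G : ℝ)⁻¹ • ∑ σ : G, polyRep ℝ ρ σ p

/-- The feasible set `{x | g₁ x ≥ 0, …, gₘ x ≥ 0}`. -/
def feasibleSet {n m : ℕ} (g : Fin m → MvPolynomial (Fin n) ℝ) : Set (Fin n → ℝ) :=
  {x | ∀ j, 0 ≤ eval x (g j)}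

/-- The feasible set is compact and some `u = u₀ + ∑ j, uⱼ gⱼ`, with `u₀, …, uₘ` sums of squares
of polynomials, has a compact level set `{x | u x ≥ 0}`. -/
def PutinarAssumption {n m : ℕ} (g : Fin m → MvPolynomial (Fin n) ℝ) : Prop :=
  IsCompact (feasibleSet g) ∧
    ∃ (u u₀ : MvPolynomial (Fin n) ℝ) (v : Fin m → MvPolynomial (Fin n) ℝ),
      IsSumSq u₀ ∧ (∀ j, IsSumSq (v j)) ∧ u = u₀ + ∑ j, v j * g j ∧
      IsCompact {x : Fin n → ℝ | 0 ≤ eval x u}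

/-- Coefficientwise real part of a complex polynomial. -/
noncomputable def rePart {n : ℕ} (p : MvPolynomial (Fin n) ℂ) : MvPolynomial (Fin n) ℝ :=
  ∑ d ∈ p.support, monomial d (coeff d p).re

/-- Coefficientwise imaginary part of a complex polynomial. -/
noncomputable def imPart {n : ℕ} (p : MvPolynomial (Fin n) ℂ) : MvPolynomial (Fin n) ℝ :=
  ∑ d ∈ p.support, monomial d (coeff d p).im

theorem coeff_rePart {n : ℕ} (p : MvPolynomial (Fin n) ℂ) (d : Fin n →₀ ℕ) :
    coeff d (rePart p) = (coeff d p).re := by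
  classical
  simp only [rePart, coeff_sum, coeff_monomial, Finset.sum_ite_eq', mem_support_iff]
  split_ifs with h <;> simp_all

theorem coeff_imPart {n : ℕ} (p : MvPolynomial (Fin n) ℂ) (d : Fin n →₀ ℕ) :
    coeff d (imPart p) = (coeff d p).im := by
  classical
  simp only [imPart, coeff_sum, coeff_monomial, Finset.sum_ite_eq', mem_support_iff]
  split_ifs with h <;> simp_all

/-- The choices behind the sets `𝒮ⁱ`: a decomposition `ℂ[X] = ⨁ i, ⨁ j ∈ J i, W i j` into
irreducible subrepresentations, where `W i j` and `W i' j'` are isomorphic exactly when `i = i'`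
(so `⨁ j, W i j` are the isotypic components), `G`-isomorphisms `φ i j : W i j₁ → W i j` out of a
chosen `W i j₁`, and a nonzero vector `s i` of `W i j₁` (by irreducibility the orbit of any nonzero
vector contains a basis of `W i j₁` with this vector as first element). -/
structure SymmetryAdaptedBasis {G : Type*} [Group G] {n : ℕ}
    (ρ : Representation ℝ G (Fin n → ℝ)) (h : ℕ) (J : Fin h → Type*) where
  W : ∀ i, J i → Subrepresentation (polyRep ℂ ρ)
  irreducible : ∀ i j, (W i j).toRepresentation.IsIrreducible
  independent : iSupIndep fun a : (Σ i, J i) => (W a.1 a.2).toSubmodule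
  spans : ⨆ a : (Σ i, J i), (W a.1 a.2).toSubmodule = ⊤
  not_iso : ∀ i i' j j', i ≠ i' →
    IsEmpty ((W i j).toRepresentation.Equiv (W i' j').toRepresentation)
  base : ∀ i, J i
  φ : ∀ i j, (W i (base i)).toRepresentation.Equiv (W i j).toRepresentation
  s : ∀ i, (W i (base i)).toSubmodule
  s_ne_zero : ∀ i, s i ≠ 0

namespace SymmetryAdaptedBasis

/-- The set `𝒮ⁱ = {φ i j (s i) | j ∈ J i}` of complex polynomials. -/
def complexSet {G : Type*} [Group G] {n : ℕ} {ρ : Representation ℝ G (Fin n → ℝ)} {h : ℕ}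
    {J : Fin h → Type*} (B : SymmetryAdaptedBasis ρ h J) (i : Fin h) :
    Set (MvPolynomial (Fin n) ℂ) :=
  Set.range fun j : J i => ((B.φ i j (B.s i) : (B.W i j).toSubmodule) : MvPolynomial (Fin n) ℂ)

/-- The real form of `𝒮ⁱ`: the real and imaginary parts of its elements. If the elements of `𝒮ⁱ`
have real coefficients, this is `𝒮ⁱ` itself together with the polynomial `0`. -/
def realSet {G : Type*} [Group G] {n : ℕ} {ρ : Representation ℝ G (Fin n → ℝ)} {h : ℕ}
    {J : Fin h → Type*} (B : SymmetryAdaptedBasis ρ h J) (i : Fin h) :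
    Set (MvPolynomial (Fin n) ℝ) :=
  rePart '' B.complexSet i ∪ imPart '' B.complexSet i

end SymmetryAdaptedBasis

/-- `q` is a (finite) sum of squares of real linear combinations of elements of `S`. -/
def IsSumSqOfSpan {n : ℕ} (S : Set (MvPolynomial (Fin n) ℝ)) (q : MvPolynomial (Fin n) ℝ) :
    Prop :=
  ∃ (N : ℕ) (p : Fin N → MvPolynomial (Fin n) ℝ),
    (∀ k, p k ∈ Submodule.span ℝ S) ∧ q = ∑ k, p k ^ 2

/-!
The proof combines Putinar's Positivstellensatz with Schur's lemma.

*Putinar.* A polynomial `f` positive on the feasible set is `s₀ + ∑ j, g j * s j` with sums of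
squares `s₀`, `s j` (`mem_generatedModule_of_pos`). This is derived from Zorn's lemma, an
elementary transfer principle for ordered fields and the algebra of quadratic modules.

* A proper preordering of a ring is mapped into the nonnegative elements of some ordered field in
  which polynomials have the intermediate value property (`IsCone.exists_ringHom_nonneg`). This
  field consists of the differences of elements of a maximal subset of an algebraically closed
  field that is closed under addition, multiplication and inversion, contains the squares of its
  differences and omits `-1` (`IsPrecone`); the intermediate value property is `IsPrecone.hasPolyIVT`.
* Sign conditions satisfiable over such an extension field of `ℝ` are satisfiable over `ℝ`
  (`exists_real_point`). Only the transfer is needed, not quantifier elimination: the sign diagrams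
  of two families of univariate polynomials, the images of one family under two ring
  homomorphisms, are matched by induction on the degree, as in the Cohen–Hörmander algorithm
  (`isSignDetermined`).
* Hence, if `u` is nonnegative only on a bounded set, `-1` lies in the preordering generated by `u`
  and `∑ i, Xᵢ² - N` for large `N`; removing the denominator puts a ball equation `N - ∑ i, Xᵢ²`
  into the preordering generated by `u` (`exists_ball_mem_adjoinCone`, after Wörmann). That
  preordering is contained in the quadratic module of the `g j`, which is therefore archimedean.
* A maximal proper quadratic module above an archimedean one is the nonnegativity set of a real
  character, that is, of a point of `ℝⁿ` (`IsQuadraticModule.exists_character`), and a short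
  iteration gives `IsQuadraticModule.mem_of_forall_character_pos`.

*Schur.* Applying the Reynolds operator to `f = s₀ + ∑ j, g j * s j` changes neither `f` nor the
factors `g j`, so it suffices to write the average of a square `p ^ 2` as the average of sums of
squares from the spans of the sets `𝒮ⁱ` (`SymmetryAdaptedBasis.exists_reynolds_sq`). The averaged
product `∑ g, (p * conj q)^g` is an invariant sesquilinear form on `ℂ[X]`. By Schur's lemma,
isotypic components of different type are orthogonal, and on the images of one irreducible
representation under `φ i j'` and `φ i j` the form is a multiple of one fixed invariant hermitian
form; the multiple is read off at `s i`. Since that hermitian form is a sum `∑ k, |ℓ k|²` of squares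
of linear forms, the polynomial `∑ j, φ i j (w j)` has the same average of `|·|²` as, up to a
positive constant, the family of the polynomials `∑ j, ℓ k (w j) • φ i j (s i)`, which lie in the
span of `𝒮ⁱ`. Finally `|t|² = (re t)² + (im t)²`.
-/

set_option linter.unusedSectionVars false

/-! ### Polynomials over ordered fields with the intermediate value property -/

/-- The intermediate value property for polynomials in one variable over an ordered field; it
characterizes the real closed fields among the ordered fields. -/
def HasPolyIVT (R : Type*) [Field R] [LinearOrder R] : Prop :=
  ∀ (p : Polynomial R) (a b : R), a < b → p.eval a * p.eval b < 0 →
    ∃ c, a < c ∧ c < b ∧ p.eval c = 0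

theorem hasPolyIVT_real : HasPolyIVT ℝ := by
  intro p a b hab h
  have hc : ContinuousOn (fun x => p.eval x) (Set.Icc a b) := p.continuous.continuousOn
  rcases mul_neg_iff.1 h with ⟨h1, h2⟩ | ⟨h1, h2⟩
  · obtain ⟨c, hc, h0⟩ := intermediate_value_Ioo' hab.le hc ⟨h2, h1⟩
    exact ⟨c, hc.1, hc.2, h0⟩
  · obtain ⟨c, hc, h0⟩ := intermediate_value_Ioo hab.le hc ⟨h1, h2⟩
    exact ⟨c, hc.1, hc.2, h0⟩

section OrderedField

variable {R : Type*} [Field R] [LinearOrder R] [IsStrictOrderedRing R]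

namespace HasPolyIVT

/-- Rolle's theorem for consecutive roots: writing `p = (X - a) ^ m * (X - b) ^ k * g` with `g`
nonzero on `[a, b]`, the remaining factor of the derivative has opposite signs at `a` and `b`. -/
theorem rolle_of_consecutive (hR : HasPolyIVT R) {p : Polynomial R} (hp : p ≠ 0) {a b : R}
    (hab : a < b) (ha : p.eval a = 0) (hb : p.eval b = 0)
    (hno : ∀ c, a < c → c < b → p.eval c ≠ 0) :
    ∃ c, a < c ∧ c < b ∧ p.derivative.eval c = 0 := by
  obtain ⟨q, hq, hqa⟩ := Polynomial.exists_eq_pow_rootMultiplicity_mul_and_not_dvd p hp a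
  have hqa' : q.eval a ≠ 0 := fun h => hqa (Polynomial.dvd_iff_isRoot.2 h)
  have hq0 : q ≠ 0 := by rintro rfl; simp at hqa'
  obtain ⟨g, hg, hgb⟩ := Polynomial.exists_eq_pow_rootMultiplicity_mul_and_not_dvd q hq0 b
  have hgb' : g.eval b ≠ 0 := fun h => hgb (Polynomial.dvd_iff_isRoot.2 h)
  have hm : 0 < p.rootMultiplicity a := (Polynomial.rootMultiplicity_pos hp).2 ha
  have hk : 0 < q.rootMultiplicity b := by
    refine (Polynomial.rootMultiplicity_pos hq0).2 ?_
    rw [hq] at hb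
    simpa [sub_eq_zero, hab.ne'] using hb
  obtain ⟨m, hm'⟩ := Nat.exists_eq_succ_of_ne_zero hm.ne'
  obtain ⟨k, hk'⟩ := Nat.exists_eq_succ_of_ne_zero hk.ne'
  rw [hm'] at hq
  rw [hk'] at hg
  have hga : g.eval a ≠ 0 := by
    intro h
    rw [hg] at hqa'
    simp [h] at hqa'
  have hpg : p = (Polynomial.X - Polynomial.C a) ^ (m + 1) *
      ((Polynomial.X - Polynomial.C b) ^ (k + 1) * g) := by rw [← hg]; exact hq
  set h : Polynomial R := Polynomial.C (m + 1 : R) * (Polynomial.X - Polynomial.C b) * g +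
    Polynomial.C (k + 1 : R) * (Polynomial.X - Polynomial.C a) * g +
    (Polynomial.X - Polynomial.C a) * (Polynomial.X - Polynomial.C b) * g.derivative with hh
  have hder : p.derivative = (Polynomial.X - Polynomial.C a) ^ m *
      (Polynomial.X - Polynomial.C b) ^ k * h := by
    rw [hpg, hh]
    simp only [Polynomial.derivative_mul, Polynomial.derivative_X_sub_C_pow]
    push_cast
    simp only [map_add, Polynomial.C_1, map_natCast]
    ring
  have hgg : 0 < g.eval a * g.eval b := by
    by_contra hcon
    have hlt : g.eval a * g.eval b < 0 :=
      lt_of_le_of_ne (not_lt.1 hcon) (mul_ne_zero hga hgb')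
    obtain ⟨c, h1, h2, h3⟩ := hR g a b hab hlt
    refine hno c h1 h2 ?_
    rw [hpg]
    simp [h3]
  have hneg : h.eval a * h.eval b < 0 := by
    have e1 : h.eval a * h.eval b =
        -(((m : R) + 1) * (k + 1) * ((b - a) * (b - a)) * (g.eval a * g.eval b)) := by
      simp only [hh, Polynomial.eval_add, Polynomial.eval_mul, Polynomial.eval_sub,
        Polynomial.eval_X, Polynomial.eval_C]
      ring
    rw [e1, neg_lt_zero]
    have : 0 < b - a := sub_pos.2 hab
    positivity
  obtain ⟨c, h1, h2, h3⟩ := hR h a b hab hneg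
  exact ⟨c, h1, h2, by rw [hder]; simp [h3]⟩

theorem rolle (hR : HasPolyIVT R) (p : Polynomial R) {a b : R}
    (hab : a < b) (ha : p.eval a = 0) (hb : p.eval b = 0) :
    ∃ c, a < c ∧ c < b ∧ p.derivative.eval c = 0 := by
  classical
  by_cases hp : p = 0
  · obtain ⟨c, h1, h2⟩ := exists_between hab
    exact ⟨c, h1, h2, by simp [hp]⟩
  have hne : (p.roots.toFinset.filter fun x => a < x).Nonempty :=
    ⟨b, by simp [hp, hb, hab]⟩
  obtain ⟨d, hd, hmin⟩ := Finset.exists_min_image _ id hne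
  simp only [Finset.mem_filter, Multiset.mem_toFinset, Polynomial.mem_roots hp,
    Polynomial.IsRoot.def, id, and_imp] at hd hmin
  obtain ⟨c, h1, h2, h3⟩ := hR.rolle_of_consecutive hp hd.2 ha hd.1
    fun c h1 h2 h3 => not_lt.2 (hmin c h3 h1) h2
  exact ⟨c, h1, h2.trans_le (hmin b hb hab), h3⟩

theorem mean_value (hR : HasPolyIVT R) (p : Polynomial R) {a b : R} (hab : a < b) :
    ∃ c, a < c ∧ c < b ∧ p.derivative.eval c * (b - a) = p.eval b - p.eval a := by
  obtain ⟨c, h1, h2, h3⟩ := hR.rolle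
    (p * Polynomial.C (b - a) - Polynomial.C (p.eval b - p.eval a) *
      (Polynomial.X - Polynomial.C a) - Polynomial.C (p.eval a * (b - a))) hab
    (by simp) (by simp; ring)
  refine ⟨c, h1, h2, ?_⟩
  simpa [Polynomial.derivative_mul, sub_eq_zero] using h3

/-- A root at which the polynomial does not change sign is accompanied by a root of the
derivative. -/
theorem derivative_root_of_touching (hR : HasPolyIVT R) (p : Polynomial R) {a u b : R}
    (hau : a < u) (hub : u < b) (hu : p.eval u = 0) (hsign : 0 < p.eval a * p.eval b) :
    ∃ c, a < c ∧ c < b ∧ p.derivative.eval c = 0 := by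
  obtain ⟨c, h1, h2, h3⟩ := hR.mean_value p hau
  obtain ⟨d, h4, h5, h6⟩ := hR.mean_value p hub
  rw [hu] at h3 h6
  have h7 : p.derivative.eval c * p.derivative.eval d < 0 := by
    have e : (p.derivative.eval c * p.derivative.eval d) * ((u - a) * (b - u)) =
        -(p.eval a * p.eval b) := by
      linear_combination h3 * (p.derivative.eval d * (b - u)) - p.eval a * h6
    have : 0 < (u - a) * (b - u) := mul_pos (sub_pos.2 hau) (sub_pos.2 hub)
    by_contra hcon
    have := mul_nonneg (not_lt.1 hcon) this.le
    linarith
  obtain ⟨e, h8, h9, h10⟩ := hR p.derivative c d (h2.trans h4) h7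
  exact ⟨e, h1.trans h8, h9.trans h5, h10⟩

theorem sign_eq_of_no_root (hR : HasPolyIVT R) (p : Polynomial R) {a b : R}
    (hab : a < b) (ha : p.eval a ≠ 0) (hb : p.eval b ≠ 0)
    (hno : ∀ c, a < c → c < b → p.eval c ≠ 0) :
    SignType.sign (p.eval a) = SignType.sign (p.eval b) := by
  have : ¬ p.eval a * p.eval b < 0 := fun h => by
    obtain ⟨c, h1, h2, h3⟩ := hR p a b hab h
    exact hno c h1 h2 h3
  rcases lt_or_gt_of_ne ha with h1 | h1 <;> rcases lt_or_gt_of_ne hb with h2 | h2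
  · rw [sign_neg h1, sign_neg h2]
  · exact absurd (mul_neg_of_neg_of_pos h1 h2) this
  · exact absurd (mul_neg_of_pos_of_neg h1 h2) this
  · rw [sign_pos h1, sign_pos h2]

end HasPolyIVT

theorem exists_pos_le_eval_of_leadingCoeff_pos (p : Polynomial R) (hp : 0 < p.leadingCoeff) :
    ∃ δ M : R, 0 < δ ∧ ∀ x, M ≤ x → δ ≤ p.eval x := by
  induction hn : p.natDegree generalizing p with
  | zero =>
    refine ⟨p.leadingCoeff, 0, hp, fun x _ => ?_⟩
    rw [Polynomial.eq_C_of_natDegree_eq_zero hn] at hp ⊢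
    simp
  | succ n ih =>
    have h1 : p.divX.natDegree = n := by
      rw [Polynomial.natDegree_divX_eq_natDegree_tsub_one, hn]
      rfl
    have h2 : p.divX.leadingCoeff = p.leadingCoeff := by
      rw [Polynomial.leadingCoeff, h1, Polynomial.coeff_divX, Polynomial.leadingCoeff, hn]
    obtain ⟨δ, M, hδ, hM⟩ := ih p.divX (h2 ▸ hp) h1
    refine ⟨1, max M (max 0 ((|p.coeff 0| + 1) / δ)), one_pos, fun x hx => ?_⟩
    have hx1 : M ≤ x := (le_max_left _ _).trans hx
    have hx2 : 0 ≤ x := (le_max_left _ _).trans ((le_max_right _ _).trans hx)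
    have hx3 : (|p.coeff 0| + 1) / δ ≤ x := (le_max_right _ _).trans ((le_max_right _ _).trans hx)
    rw [div_le_iff₀ hδ] at hx3
    have h3 : p.eval x = x * p.divX.eval x + p.coeff 0 := by
      have := congrArg (Polynomial.eval x) (Polynomial.X_mul_divX_add p)
      rw [Polynomial.eval_add, Polynomial.eval_mul, Polynomial.eval_X, Polynomial.eval_C] at this
      exact this.symm
    have h4 := mul_le_mul_of_nonneg_left (hM x hx1) hx2
    have := neg_abs_le (p.coeff 0)
    linarith

theorem exists_forall_ge_sign_eval (p : Polynomial R) :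
    ∃ M : R, ∀ x, M ≤ x → SignType.sign (p.eval x) = SignType.sign p.leadingCoeff := by
  rcases lt_trichotomy p.leadingCoeff 0 with h | h | h
  · obtain ⟨δ, M, hδ, hM⟩ := exists_pos_le_eval_of_leadingCoeff_pos (-p) (by simpa using h)
    refine ⟨M, fun x hx => ?_⟩
    have := hM x hx
    rw [Polynomial.eval_neg] at this
    rw [sign_neg h, sign_neg (by linarith)]
  · rw [Polynomial.leadingCoeff_eq_zero] at h
    exact ⟨0, fun x _ => by simp [h]⟩
  · obtain ⟨δ, M, hδ, hM⟩ := exists_pos_le_eval_of_leadingCoeff_pos p h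
    exact ⟨M, fun x hx => by rw [sign_pos h, sign_pos (hδ.trans_le (hM x hx))]⟩

theorem exists_forall_le_sign_eval (p : Polynomial R) :
    ∃ M : R, ∀ x, x ≤ M →
      SignType.sign (p.eval x) = (-1) ^ p.natDegree * SignType.sign p.leadingCoeff := by
  obtain ⟨M, hM⟩ := exists_forall_ge_sign_eval (p.comp (-Polynomial.X))
  refine ⟨-M, fun x hx => ?_⟩
  have := hM (-x) (le_neg_of_le_neg hx)
  rw [Polynomial.eval_comp, Polynomial.leadingCoeff_comp (by simp), sign_mul] at this
  simp only [Polynomial.eval_neg, Polynomial.eval_X, neg_neg, Polynomial.leadingCoeff_neg,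
    Polynomial.leadingCoeff_X, sign_pow] at this
  rw [this, mul_comm, Left.sign_neg, sign_one]

end OrderedField

/-! ### Matching the sign diagrams of two families of polynomials -/

section Matching

variable {R S : Type*} [LinearOrder R] [LinearOrder S]

/-- `u` and `v` lie in the same position with respect to the finitely many pairs `Z`. -/
def SamePos (Z : Finset (R × S)) (u : R) (v : S) : Prop :=
  ∀ a ∈ Z, (a.1 < u ↔ a.2 < v) ∧ (u < a.1 ↔ v < a.2)

/-- The finite set `Z` of pairs is the graph of an order isomorphism between its two projections. -/
def IsMatching (Z : Finset (R × S)) : Prop :=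
  ∀ b ∈ Z, SamePos Z b.1 b.2

theorem SamePos.eq_iff {Z : Finset (R × S)} {u : R} {v : S} (h : SamePos Z u v) {a : R × S}
    (ha : a ∈ Z) : a.1 = u ↔ a.2 = v := by
  have h1 := h a ha
  constructor
  · intro e
    have h2 := mt h1.1.2 e.not_lt
    have h3 := mt h1.2.2 e.not_gt
    exact le_antisymm (not_lt.1 h3) (not_lt.1 h2)
  · intro e
    have h2 := mt h1.1.1 e.not_lt
    have h3 := mt h1.2.1 e.not_gt
    exact le_antisymm (not_lt.1 h3) (not_lt.1 h2)

theorem SamePos.mono {Z Z' : Finset (R × S)} {u : R} {v : S} (h : SamePos Z' u v) (hZ : Z ⊆ Z') :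
    SamePos Z u v := fun a ha => h a (hZ ha)

theorem IsMatching.mono {Z Z' : Finset (R × S)} (h : IsMatching Z') (hZ : Z ⊆ Z') :
    IsMatching Z := fun b hb => (h b (hZ hb)).mono hZ

theorem samePos_insert [DecidableEq (R × S)] {Z : Finset (R × S)} {c : R × S} {u : R} {v : S} :
    SamePos (insert c Z) u v ↔
      ((c.1 < u ↔ c.2 < v) ∧ (u < c.1 ↔ v < c.2)) ∧ SamePos Z u v := by
  simp [SamePos]

theorem IsMatching.insert [DecidableEq (R × S)] {Z : Finset (R × S)} (hZ : IsMatching Z)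
    {u : R} {v : S} (h : SamePos Z u v) : IsMatching (insert (u, v) Z) := by
  intro b hb
  rw [samePos_insert]
  rcases Finset.mem_insert.1 hb with rfl | hb
  · simpa using h
  · exact ⟨⟨(h b hb).2, (h b hb).1⟩, hZ b hb⟩

/-- The pairs of `Z` with their two entries exchanged. -/
def swapPairs (Z : Finset (R × S)) : Finset (S × R) := Z.map (Equiv.prodComm R S).toEmbedding

theorem mem_swapPairs {Z : Finset (R × S)} {a : S × R} : a ∈ swapPairs Z ↔ a.swap ∈ Z := by
  simp only [swapPairs, Finset.mem_map_equiv]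
  rfl

theorem samePos_swap {Z : Finset (R × S)} {u : R} {v : S} :
    SamePos (swapPairs Z) v u ↔ SamePos Z u v := by
  constructor
  · intro h a ha
    have := h a.swap (mem_swapPairs.2 (by simpa using ha))
    exact ⟨this.1.symm, this.2.symm⟩
  · intro h a ha
    have := h a.swap (mem_swapPairs.1 ha)
    exact ⟨this.1.symm, this.2.symm⟩

theorem IsMatching.swap {Z : Finset (R × S)} (h : IsMatching Z) : IsMatching (swapPairs Z) :=
  fun _ hb => samePos_swap.2 (h _ (mem_swapPairs.1 hb))

theorem IsMatching.exists_samePos [DenselyOrdered S] [NoMinOrder S] [NoMaxOrder S] [Nonempty S]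
    {Z : Finset (R × S)} (hZ : IsMatching Z) (u : R) : ∃ v, SamePos Z u v := by
  classical
  by_cases h : ∃ a ∈ Z, a.1 = u
  · obtain ⟨a, ha, rfl⟩ := h
    exact ⟨a.2, hZ a ha⟩
  push Not at h
  obtain ⟨v, h1, h2⟩ := Order.exists_between_finsets
    ((Z.filter fun a => a.1 < u).image Prod.snd) ((Z.filter fun a => u < a.1).image Prod.snd) (by
      simp only [Finset.mem_image, Finset.mem_filter]
      rintro _ ⟨a, ⟨ha, hau⟩, rfl⟩ _ ⟨b, ⟨hb, hub⟩, rfl⟩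
      exact ((hZ b hb) a ha).1.1 (hau.trans hub))
  refine ⟨v, fun a ha => ?_⟩
  rcases lt_or_gt_of_ne (h a ha) with hlt | hlt
  · have := h1 a.2 (Finset.mem_image_of_mem _ (Finset.mem_filter.2 ⟨ha, hlt⟩))
    exact ⟨iff_of_true hlt this, iff_of_false hlt.not_gt this.not_gt⟩
  · have := h2 a.2 (Finset.mem_image_of_mem _ (Finset.mem_filter.2 ⟨ha, hlt⟩))
    exact ⟨iff_of_false hlt.not_gt this.not_gt, iff_of_true hlt this⟩

/-- The two neighbours in `Z` of a point that is not itself the first entry of a pair in `Z`. -/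
theorem exists_neighbours {Z : Finset (R × S)} {u : R} (hu : ∀ a ∈ Z, a.1 ≠ u)
    (hlo : ∃ a ∈ Z, a.1 < u) (hhi : ∃ a ∈ Z, u < a.1) :
    ∃ a ∈ Z, ∃ b ∈ Z, a.1 < u ∧ u < b.1 ∧ ∀ c ∈ Z, c.1 ≤ a.1 ∨ b.1 ≤ c.1 := by
  classical
  obtain ⟨a₀, ha₀, hau₀⟩ := hlo
  obtain ⟨b₀, hb₀, hub₀⟩ := hhi
  obtain ⟨a, ha, hamax⟩ := Finset.exists_max_image (Z.filter fun a => a.1 < u) Prod.fst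
    ⟨a₀, Finset.mem_filter.2 ⟨ha₀, hau₀⟩⟩
  obtain ⟨b, hb, hbmin⟩ := Finset.exists_min_image (Z.filter fun a => u < a.1) Prod.fst
    ⟨b₀, Finset.mem_filter.2 ⟨hb₀, hub₀⟩⟩
  rw [Finset.mem_filter] at ha hb
  refine ⟨a, ha.1, b, hb.1, ha.2, hb.2, fun c hc => ?_⟩
  rcases lt_or_gt_of_ne (hu c hc) with h | h
  · exact Or.inl (hamax c (Finset.mem_filter.2 ⟨hc, h⟩))
  · exact Or.inr (hbmin c (Finset.mem_filter.2 ⟨hc, h⟩))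

/-- A point strictly between two consecutive pairs is in the same position as any other such
point. -/
theorem IsMatching.samePos_of_between {Z : Finset (R × S)} (hZ : IsMatching Z) {a b : R × S}
    (ha : a ∈ Z) (hb : b ∈ Z) (hcons : ∀ c ∈ Z, c.1 ≤ a.1 ∨ b.1 ≤ c.1) {u : R} {v : S}
    (hau : a.1 < u) (hub : u < b.1) (hav : a.2 < v) (hvb : v < b.2) : SamePos Z u v := by
  intro c hc
  rcases hcons c hc with h | h
  · have h2 : c.2 ≤ a.2 := by
      rw [← not_lt] at h ⊢
      exact mt (hZ a ha c hc).2.2 h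
    have h3 := h.trans_lt hau
    have h4 := h2.trans_lt hav
    exact ⟨iff_of_true h3 h4, iff_of_false h3.not_gt h4.not_gt⟩
  · have h2 : b.2 ≤ c.2 := by
      rw [← not_lt] at h ⊢
      exact mt (hZ b hb c hc).1.2 h
    have h3 := hub.trans_le h
    have h4 := hvb.trans_le h2
    exact ⟨iff_of_false h3.not_gt h4.not_gt, iff_of_true h3 h4⟩

end Matching

section SignDiagram

variable {R S : Type*} [Field R] [LinearOrder R] [IsStrictOrderedRing R]
  [Field S] [LinearOrder S] [IsStrictOrderedRing S]

/-- Points in the same position with respect to `Z` give `p` and `q` the same sign. -/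
def SameSigns (Z : Finset (R × S)) (p : Polynomial R) (q : Polynomial S) : Prop :=
  ∀ u v, SamePos Z u v → SignType.sign (p.eval u) = SignType.sign (q.eval v)

theorem SameSigns.mono {Z Z' : Finset (R × S)} {p : Polynomial R} {q : Polynomial S}
    (h : SameSigns Z p q) (hZ : Z ⊆ Z') : SameSigns Z' p q := fun u v huv => h u v (huv.mono hZ)

theorem SameSigns.swap {Z : Finset (R × S)} {p : Polynomial R} {q : Polynomial S}
    (h : SameSigns Z p q) : SameSigns (swapPairs Z) q p :=
  fun _ _ huv => (h _ _ (samePos_swap.1 huv)).symm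

theorem SameSigns.eq_zero {Z : Finset (R × S)} (hZ : IsMatching Z) {p : Polynomial R}
    {q : Polynomial S} (h : SameSigns Z p q) (hp : p = 0) : q = 0 := by
  refine Polynomial.funext fun v => ?_
  obtain ⟨u, hu⟩ := hZ.swap.exists_samePos v
  have := h u v (samePos_swap.1 hu)
  rw [hp, Polynomial.eval_zero, sign_zero, eq_comm, sign_eq_zero_iff] at this
  rw [this, Polynomial.eval_zero]

/-- The roots of a nonzero polynomial occur in any matching that determines its signs. -/
theorem SameSigns.exists_fst_eq {Z : Finset (R × S)} (hZ : IsMatching Z) {p : Polynomial R}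
    {q : Polynomial S} (h : SameSigns Z p q) (hp : p ≠ 0) {u : R} (hu : p.eval u = 0) :
    ∃ a ∈ Z, a.1 = u := by
  classical
  by_contra hcon
  push Not at hcon
  obtain ⟨v, hv⟩ := hZ.exists_samePos u
  obtain ⟨w, h1, h2⟩ := Order.exists_between_finsets {u}
    ((Z.filter fun a => u < a.1).image Prod.fst) (by
      simp only [Finset.mem_image, Finset.mem_filter, Finset.mem_singleton]
      rintro _ rfl _ ⟨b, ⟨hb, hub⟩, rfl⟩
      exact hub)
  have huw : u < w := h1 u (Finset.mem_singleton_self u)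
  have hq : SignType.sign (q.eval v) = 0 := by rw [← h u v hv, hu, sign_zero]
  -- The whole interval `(u, w)` lies in the position of `v`, hence consists of roots.
  refine (Set.Ioo_infinite huw).not_finite (Set.Finite.subset p.roots.toFinset.finite_toSet ?_)
  intro x hx
  have hx' : SamePos Z x v := by
    intro a ha
    rcases lt_or_gt_of_ne (hcon a ha) with hlt | hlt
    · have h3 := (hv a ha).1.1 hlt
      have h4 := hlt.trans hx.1
      exact ⟨iff_of_true h4 h3, iff_of_false h4.not_gt h3.not_gt⟩
    · have h3 := (hv a ha).2.1 hlt
      have h4 := hx.2.trans (h2 a.1 (Finset.mem_image_of_mem _ (Finset.mem_filter.2 ⟨ha, hlt⟩)))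
      exact ⟨iff_of_false h4.not_gt h3.not_gt, iff_of_true h4 h3⟩
  have := h x v hx'
  rw [hq, sign_eq_zero_iff] at this
  simpa [hp] using this

/-- Two points in the same position with respect to a set containing the roots of `q` give `q` the
same sign. -/
theorem HasPolyIVT.sign_eq_of_same_position (hS : HasPolyIVT S) {Z : Finset (R × S)}
    {q : Polynomial S} (hroots : ∀ w, q.eval w = 0 → ∃ a ∈ Z, a.2 = w) {u : R} {v v' : S}
    (h : SamePos Z u v) (h' : SamePos Z u v') :
    SignType.sign (q.eval v) = SignType.sign (q.eval v') := by
  wlog hvv : v ≤ v' generalizing v v'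
  · exact (this h' h (le_of_not_ge hvv)).symm
  rcases hvv.eq_or_lt with rfl | hlt
  · rfl
  have key : ∀ w, v ≤ w → w ≤ v' → q.eval w ≠ 0 := by
    intro w h1 h2 h0
    obtain ⟨a, ha, rfl⟩ := hroots w h0
    have e1 : a.2 < v ↔ a.2 < v' := (h a ha).1.symm.trans (h' a ha).1
    have e2 : v < a.2 ↔ v' < a.2 := (h a ha).2.symm.trans (h' a ha).2
    rcases h2.eq_or_lt with h3 | h3
    · exact (e2.1 (h3 ▸ hlt)).ne' h3
    · exact (e1.2 h3).not_ge h1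
  exact hS.sign_eq_of_no_root q hlt (key v le_rfl hvv) (key v' hvv le_rfl)
    fun c h1 h2 => key c h1.le h2.le

end SignDiagram

/-! ### Adjoining a polynomial to a matched family -/

section SignDiagramStep

variable {R S : Type*} [Field R] [LinearOrder R] [IsStrictOrderedRing R]
  [Field S] [LinearOrder S] [IsStrictOrderedRing S]

/-- If `Z` contains all roots of the derivative of `P`, records the same signs for `P` and `Q`, and
surrounds the roots of `P`, then every root of `P` has a counterpart among the roots of `Q`. -/
theorem exists_root_samePos (hR : HasPolyIVT R) (hS : HasPolyIVT S) {Z : Finset (R × S)}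
    (hZ : IsMatching Z) {P : Polynomial R} {Q : Polynomial S}
    (hsign : ∀ a ∈ Z, SignType.sign (P.eval a.1) = SignType.sign (Q.eval a.2))
    (hder : ∀ w, P.derivative.eval w = 0 → ∃ a ∈ Z, a.1 = w)
    (hlo : ∃ a ∈ Z, ∀ x ≤ a.1, P.eval x ≠ 0) (hhi : ∃ a ∈ Z, ∀ x, a.1 ≤ x → P.eval x ≠ 0)
    {u : R} (hu : P.eval u = 0) : ∃ v, Q.eval v = 0 ∧ SamePos Z u v := by
  by_cases huZ : ∃ a ∈ Z, a.1 = u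
  · obtain ⟨a, ha, rfl⟩ := huZ
    refine ⟨a.2, ?_, hZ a ha⟩
    rw [← sign_eq_zero_iff, ← hsign a ha, hu, sign_zero]
  push Not at huZ
  obtain ⟨lo, hloZ, hlo⟩ := hlo
  obtain ⟨hi, hhiZ, hhi⟩ := hhi
  obtain ⟨a, ha, b, hb, hau, hub, hcons⟩ := exists_neighbours huZ
    ⟨lo, hloZ, not_le.1 fun h => hlo u h hu⟩ ⟨hi, hhiZ, not_le.1 fun h => hhi u h hu⟩
  have hnoder : ∀ c, a.1 < c → c < b.1 → P.derivative.eval c ≠ 0 := by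
    intro c h1 h2 h0
    obtain ⟨e, he, rfl⟩ := hder c h0
    rcases hcons e he with h | h
    · exact h.not_gt h1
    · exact h.not_gt h2
  have hPa : P.eval a.1 ≠ 0 := fun h => by
    obtain ⟨c, h1, h2, h3⟩ := hR.rolle P hau h hu
    exact hnoder c h1 (h2.trans hub) h3
  have hPb : P.eval b.1 ≠ 0 := fun h => by
    obtain ⟨c, h1, h2, h3⟩ := hR.rolle P hub hu h
    exact hnoder c (hau.trans h1) h2 h3
  have hP : P.eval a.1 * P.eval b.1 < 0 := by
    by_contra hcon
    obtain ⟨c, h1, h2, h3⟩ := hR.derivative_root_of_touching P hau hub hu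
      (lt_of_le_of_ne (not_lt.1 hcon) (mul_ne_zero hPa hPb).symm)
    exact hnoder c h1 h2 h3
  have hQ : Q.eval a.2 * Q.eval b.2 < 0 := by
    rw [← sign_eq_neg_one_iff, sign_mul] at hP ⊢
    rwa [← hsign a ha, ← hsign b hb]
  have hab : a.2 < b.2 := (hZ b hb a ha).1.1 (hau.trans hub)
  obtain ⟨v, h1, h2, h3⟩ := hS Q a.2 b.2 hab hQ
  exact ⟨v, h3, hZ.samePos_of_between ha hb hcons hau hub h1 h2⟩

/-- If `Z` contains all roots of `P`, of `Q` and of the derivative of `P`, records the same signs,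
and the signs agree near the two ends, then `Z` determines the signs of `P` and `Q`. -/
theorem sameSigns_of_roots_matched (hR : HasPolyIVT R) (hS : HasPolyIVT S) {Z : Finset (R × S)}
    (hZ : IsMatching Z) {P : Polynomial R} {Q : Polynomial S}
    (hsign : ∀ a ∈ Z, SignType.sign (P.eval a.1) = SignType.sign (Q.eval a.2))
    (hder : ∀ w, P.derivative.eval w = 0 → ∃ a ∈ Z, a.1 = w)
    (hP : ∀ w, P.eval w = 0 → ∃ a ∈ Z, a.1 = w) (hQ : ∀ w, Q.eval w = 0 → ∃ a ∈ Z, a.2 = w)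
    (hlo : ∃ a ∈ Z, ∀ x ≤ a.1, ∀ y ≤ a.2, SignType.sign (P.eval x) = SignType.sign (Q.eval y))
    (hhi : ∃ a ∈ Z, ∀ x, a.1 ≤ x → ∀ y, a.2 ≤ y →
      SignType.sign (P.eval x) = SignType.sign (Q.eval y)) :
    SameSigns Z P Q := by
  intro u v huv
  by_cases huZ : ∃ a ∈ Z, a.1 = u
  · obtain ⟨a, ha, rfl⟩ := huZ
    rw [hsign a ha, (huv.eq_iff ha).1 rfl]
  have hPu : P.eval u ≠ 0 := fun h => huZ (hP u h)
  have hQv : Q.eval v ≠ 0 := fun h => huZ (by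
    obtain ⟨a, ha, rfl⟩ := hQ v h
    exact ⟨a, ha, (huv.eq_iff ha).2 rfl⟩)
  push Not at huZ
  obtain ⟨lo, hloZ, hlo⟩ := hlo
  obtain ⟨hi, hhiZ, hhi⟩ := hhi
  by_cases h1 : lo.1 < u
  swap
  · exact hlo u (not_lt.1 h1) v (not_lt.1 (mt (huv lo hloZ).1.2 h1))
  by_cases h2 : u < hi.1
  swap
  · exact hhi u (not_lt.1 h2) v (not_lt.1 (mt (huv hi hhiZ).2.2 h2))
  obtain ⟨a, ha, b, hb, hau, hub, hcons⟩ := exists_neighbours huZ ⟨lo, hloZ, h1⟩ ⟨hi, hhiZ, h2⟩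
  have hav : a.2 < v := (huv a ha).1.1 hau
  have hvb : v < b.2 := (huv b hb).2.1 hub
  have hab := hau.trans hub
  have hcap : ∀ c ∈ Z, ¬ (a.1 < c.1 ∧ c.1 < b.1) := fun c hc h => by
    rcases hcons c hc with h' | h'
    · exact h'.not_gt h.1
    · exact h'.not_gt h.2
  have hnoP : ∀ c, a.1 < c → c < b.1 → P.eval c ≠ 0 := by
    intro c h1 h2 h0
    obtain ⟨e, he, rfl⟩ := hP c h0
    exact hcap e he ⟨h1, h2⟩
  have hnoQ : ∀ c, a.2 < c → c < b.2 → Q.eval c ≠ 0 := by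
    intro c h1 h2 h0
    obtain ⟨e, he, rfl⟩ := hQ c h0
    exact hcap e he ⟨(hZ e he a ha).1.2 h1, (hZ e he b hb).2.2 h2⟩
  by_contra hne
  -- Both neighbours are roots, so Rolle's theorem gives a root of the derivative between them.
  have hPa : P.eval a.1 = 0 := by
    by_contra h0
    have h0' : Q.eval a.2 ≠ 0 := by rwa [← sign_ne_zero, ← hsign a ha, sign_ne_zero]
    apply hne
    rw [← hR.sign_eq_of_no_root P hau h0 hPu fun c h1 h2 => hnoP c h1 (h2.trans hub),
      ← hS.sign_eq_of_no_root Q hav h0' hQv fun c h1 h2 => hnoQ c h1 (h2.trans hvb), hsign a ha]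
  have hPb : P.eval b.1 = 0 := by
    by_contra h0
    have h0' : Q.eval b.2 ≠ 0 := by rwa [← sign_ne_zero, ← hsign b hb, sign_ne_zero]
    apply hne
    rw [hR.sign_eq_of_no_root P hub hPu h0 fun c h1 h2 => hnoP c (hau.trans h1) h2,
      hS.sign_eq_of_no_root Q hvb hQv h0' fun c h1 h2 => hnoQ c (hav.trans h1) h2, hsign b hb]
  obtain ⟨c, h3, h4, h5⟩ := hR.rolle P hab hPa hPb
  obtain ⟨e, he, rfl⟩ := hder c h5
  exact hcap e he ⟨h3, h4⟩

/-- Discarding from a matching the points at which no member of the family vanishes. -/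
theorem exists_matching_of_roots (hS : HasPolyIVT S)
    {Z : Finset (R × S)} (hZ : IsMatching Z) (F : Set (Polynomial R × Polynomial S))
    (hF : ∀ pq ∈ F, SameSigns Z pq.1 pq.2) :
    ∃ Z₀ : Finset (R × S), Z₀ ⊆ Z ∧ (∀ a ∈ Z₀, ∃ pq ∈ F, pq.1 ≠ 0 ∧ pq.1.eval a.1 = 0) ∧
      (∀ pq ∈ F, SameSigns Z₀ pq.1 pq.2) ∧
      (∀ pq ∈ F, pq.1 ≠ 0 → ∀ w, pq.1.eval w = 0 → ∃ a ∈ Z₀, a.1 = w) ∧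
      (∀ pq ∈ F, pq.2 ≠ 0 → ∀ w, pq.2.eval w = 0 → ∃ a ∈ Z₀, a.2 = w) := by
  classical
  set Z₀ := Z.filter fun a => ∃ pq ∈ F, pq.1 ≠ 0 ∧ pq.1.eval a.1 = 0 with hZ₀
  have hsub : Z₀ ⊆ Z := Finset.filter_subset _ _
  have hr1 : ∀ pq ∈ F, pq.1 ≠ 0 → ∀ w, pq.1.eval w = 0 → ∃ a ∈ Z₀, a.1 = w := by
    intro pq hpq h0 w hw
    obtain ⟨a, ha, rfl⟩ := (hF pq hpq).exists_fst_eq hZ h0 hw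
    exact ⟨a, Finset.mem_filter.2 ⟨ha, pq, hpq, h0, hw⟩, rfl⟩
  have hr2 : ∀ pq ∈ F, pq.2 ≠ 0 → ∀ w, pq.2.eval w = 0 → ∃ a ∈ Z₀, a.2 = w := by
    intro pq hpq h0 w hw
    obtain ⟨a, ha, rfl⟩ := (hF pq hpq).swap.exists_fst_eq hZ.swap h0 hw
    rw [mem_swapPairs] at ha
    refine ⟨a.swap, Finset.mem_filter.2 ⟨ha, pq, hpq, fun h => h0 ((hF pq hpq).eq_zero hZ h), ?_⟩,
      rfl⟩
    rw [← sign_eq_zero_iff, hF pq hpq _ _ (hZ _ ha), sign_eq_zero_iff]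
    exact hw
  refine ⟨Z₀, hsub, fun a ha => (Finset.mem_filter.1 ha).2, fun pq hpq u v huv => ?_, hr1, hr2⟩
  obtain ⟨v', hv'⟩ := hZ.exists_samePos u
  rw [hF pq hpq u v' hv']
  by_cases h0 : pq.2 = 0
  · simp [h0]
  · exact hS.sign_eq_of_same_position (hr2 pq hpq h0) (hv'.mono hsub) huv

/-- Enlarging a matching by a pair of points beyond all of its points, at which two polynomials with
leading coefficients of equal sign have settled to their sign near `+∞`. -/
theorem exists_matching_insert_top {Z : Finset (R × S)} (hZ : IsMatching Z) (P : Polynomial R)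
    (Q : Polynomial S) (hP : P ≠ 0) (hQ : Q ≠ 0)
    (hlc : SignType.sign P.leadingCoeff = SignType.sign Q.leadingCoeff) :
    ∃ Z₁ : Finset (R × S), Z ⊆ Z₁ ∧ IsMatching Z₁ ∧
      (∀ a ∈ Z₁, a ∈ Z ∨ SignType.sign (P.eval a.1) = SignType.sign (Q.eval a.2)) ∧
      ∃ a ∈ Z₁, (∀ x, a.1 ≤ x → ∀ y, a.2 ≤ y →
        SignType.sign (P.eval x) = SignType.sign (Q.eval y)) ∧
        (∀ x, a.1 ≤ x → P.eval x ≠ 0) ∧ (∀ y, a.2 ≤ y → Q.eval y ≠ 0) := by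
  classical
  obtain ⟨M, hM⟩ := exists_forall_ge_sign_eval P
  obtain ⟨N, hN⟩ := exists_forall_ge_sign_eval Q
  obtain ⟨u, hu, -⟩ := Order.exists_between_finsets (insert M (Z.image Prod.fst)) ∅ (by simp)
  obtain ⟨v, hv, -⟩ := Order.exists_between_finsets (insert N (Z.image Prod.snd)) ∅ (by simp)
  have huM : M ≤ u := (hu M (Finset.mem_insert_self _ _)).le
  have hvN : N ≤ v := (hv N (Finset.mem_insert_self _ _)).le
  have hpos : SamePos Z u v := fun a ha => by
    have h1 := hu a.1 (Finset.mem_insert_of_mem (Finset.mem_image_of_mem _ ha))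
    have h2 := hv a.2 (Finset.mem_insert_of_mem (Finset.mem_image_of_mem _ ha))
    exact ⟨iff_of_true h1 h2, iff_of_false h1.not_gt h2.not_gt⟩
  refine ⟨insert (u, v) Z, Finset.subset_insert _ _, hZ.insert hpos, fun a ha => ?_, (u, v),
    Finset.mem_insert_self _ _, fun x hx y hy => ?_, fun x hx => ?_, fun y hy => ?_⟩
  · rcases Finset.mem_insert.1 ha with rfl | ha
    · exact Or.inr (by rw [hM u huM, hN v hvN, hlc])
    · exact Or.inl ha
  · rw [hM x (huM.trans hx), hN y (hvN.trans hy), hlc]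
  · rw [← sign_ne_zero, hM x (huM.trans hx), sign_ne_zero]
    exact Polynomial.leadingCoeff_ne_zero.2 hP
  · rw [← sign_ne_zero, hN y (hvN.trans hy), sign_ne_zero]
    exact Polynomial.leadingCoeff_ne_zero.2 hQ

/-- The counterpart of `exists_matching_insert_top` near `-∞`. -/
theorem exists_matching_insert_bot {Z : Finset (R × S)} (hZ : IsMatching Z) (P : Polynomial R)
    (Q : Polynomial S) (hP : P ≠ 0) (hQ : Q ≠ 0) (hdeg : P.natDegree = Q.natDegree)
    (hlc : SignType.sign P.leadingCoeff = SignType.sign Q.leadingCoeff) :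
    ∃ Z₁ : Finset (R × S), Z ⊆ Z₁ ∧ IsMatching Z₁ ∧
      (∀ a ∈ Z₁, a ∈ Z ∨ SignType.sign (P.eval a.1) = SignType.sign (Q.eval a.2)) ∧
      ∃ a ∈ Z₁, (∀ x ≤ a.1, ∀ y ≤ a.2, SignType.sign (P.eval x) = SignType.sign (Q.eval y)) ∧
        (∀ x ≤ a.1, P.eval x ≠ 0) ∧ (∀ y ≤ a.2, Q.eval y ≠ 0) := by
  classical
  obtain ⟨M, hM⟩ := exists_forall_le_sign_eval P
  obtain ⟨N, hN⟩ := exists_forall_le_sign_eval Q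
  obtain ⟨u, -, hu⟩ := Order.exists_between_finsets ∅ (insert M (Z.image Prod.fst)) (by simp)
  obtain ⟨v, -, hv⟩ := Order.exists_between_finsets ∅ (insert N (Z.image Prod.snd)) (by simp)
  have huM : u ≤ M := (hu M (Finset.mem_insert_self _ _)).le
  have hvN : v ≤ N := (hv N (Finset.mem_insert_self _ _)).le
  have hpos : SamePos Z u v := fun a ha => by
    have h1 := hu a.1 (Finset.mem_insert_of_mem (Finset.mem_image_of_mem _ ha))
    have h2 := hv a.2 (Finset.mem_insert_of_mem (Finset.mem_image_of_mem _ ha))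
    exact ⟨iff_of_false h1.not_gt h2.not_gt, iff_of_true h1 h2⟩
  have hne : ∀ k : ℕ, ((-1 : SignType) ^ k) ≠ 0 := fun k => pow_ne_zero k (by decide)
  refine ⟨insert (u, v) Z, Finset.subset_insert _ _, hZ.insert hpos, fun a ha => ?_, (u, v),
    Finset.mem_insert_self _ _, fun x hx y hy => ?_, fun x hx => ?_, fun y hy => ?_⟩
  · rcases Finset.mem_insert.1 ha with rfl | ha
    · exact Or.inr (by rw [hM u huM, hN v hvN, hlc, hdeg])
    · exact Or.inl ha
  · rw [hM x (hx.trans huM), hN y (hy.trans hvN), hlc, hdeg]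
  · rw [← sign_ne_zero, hM x (hx.trans huM)]
    exact mul_ne_zero (hne _) (sign_ne_zero.2 (Polynomial.leadingCoeff_ne_zero.2 hP))
  · rw [← sign_ne_zero, hN y (hy.trans hvN)]
    exact mul_ne_zero (hne _) (sign_ne_zero.2 (Polynomial.leadingCoeff_ne_zero.2 hQ))

/-- The inductive step in the comparison of sign diagrams: a matching for a family `F` containing
the derivatives of `P` and `Q` that also controls the signs of `P` and `Q` at the roots of the
members of `F` can be replaced by a matching for `F` together with `(P, Q)`. -/
theorem exists_matching_adjoin (hR : HasPolyIVT R) (hS : HasPolyIVT S) {Z : Finset (R × S)}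
    (hZ : IsMatching Z) (F : Set (Polynomial R × Polynomial S))
    (hF : ∀ pq ∈ F, SameSigns Z pq.1 pq.2) (P : Polynomial R) (Q : Polynomial S)
    (hder : (P.derivative, Q.derivative) ∈ F)
    (hP' : P.derivative ≠ 0) (hQ' : Q.derivative ≠ 0) (hdeg : P.natDegree = Q.natDegree)
    (hlc : SignType.sign P.leadingCoeff = SignType.sign Q.leadingCoeff)
    (hrem : ∀ pq ∈ F, pq.1 ≠ 0 → ∀ a ∈ Z, pq.1.eval a.1 = 0 →
      SignType.sign (P.eval a.1) = SignType.sign (Q.eval a.2)) :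
    ∃ Z' : Finset (R × S), IsMatching Z' ∧ SameSigns Z' P Q ∧ ∀ pq ∈ F, SameSigns Z' pq.1 pq.2 := by
  classical
  have hP : P ≠ 0 := by rintro rfl; simp at hP'
  have hQ : Q ≠ 0 := by rintro rfl; simp at hQ'
  obtain ⟨Z₀, hsub, hroot, hF₀, hr1, hr2⟩ := exists_matching_of_roots hS hZ F hF
  obtain ⟨Z₁, hZ₁, hm₁, hs₁, hi, hhi, hhi1, hhi2, hhi3⟩ :=
    exists_matching_insert_top (hZ.mono hsub) P Q hP hQ hlc
  obtain ⟨Z₂, hZ₂, hm₂, hs₂, lo, hlo, hlo1, hlo2, hlo3⟩ :=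
    exists_matching_insert_bot hm₁ P Q hP hQ hdeg hlc
  have hs : ∀ a ∈ Z₂, SignType.sign (P.eval a.1) = SignType.sign (Q.eval a.2) := by
    intro a ha
    rcases hs₂ a ha with ha | h
    · rcases hs₁ a ha with ha | h
      · obtain ⟨pq, hpq, h1, h2⟩ := hroot a ha
        exact hrem pq hpq h1 a (hsub ha) h2
      · exact h
    · exact h
  have hd1 : ∀ w, P.derivative.eval w = 0 → ∃ a ∈ Z₂, a.1 = w := fun w hw => by
    obtain ⟨a, ha, h⟩ := hr1 _ hder hP' w hw
    exact ⟨a, hZ₂ (hZ₁ ha), h⟩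
  have hd2 : ∀ w, Q.derivative.eval w = 0 → ∃ a ∈ Z₂, a.2 = w := fun w hw => by
    obtain ⟨a, ha, h⟩ := hr2 _ hder hQ' w hw
    exact ⟨a, hZ₂ (hZ₁ ha), h⟩
  set T : Finset (R × S) := (P.roots.toFinset ×ˢ Q.roots.toFinset).filter
    fun a => SamePos Z₂ a.1 a.2 with hT
  have hmemT : ∀ a : R × S, a ∈ T ↔ (P.eval a.1 = 0 ∧ Q.eval a.2 = 0) ∧ SamePos Z₂ a.1 a.2 := by
    intro a
    simp [hT, hP, hQ]
  have hmT : ∀ a ∈ Z₂ ∪ T, SamePos Z₂ a.1 a.2 := by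
    intro a ha
    rcases Finset.mem_union.1 ha with ha | ha
    · exact hm₂ a ha
    · exact ((hmemT a).1 ha).2
  have hm : IsMatching (Z₂ ∪ T) := by
    intro b hb a ha
    rcases Finset.mem_union.1 ha with ha' | ha'
    · exact hmT b hb a ha'
    rcases Finset.mem_union.1 hb with hb' | hb'
    · have := hmT a ha b hb'
      exact ⟨this.2, this.1⟩
    -- Two roots are separated by a root of the derivative.
    have key : ∀ c ∈ T, ∀ e ∈ T, (c.1 < e.1 ↔ c.2 < e.2) := by
      intro c hc e he
      rw [hmemT] at hc he
      constructor
      · intro h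
        obtain ⟨w, h1, h2, h3⟩ := hR.rolle P h hc.1.1 he.1.1
        obtain ⟨z, hz, rfl⟩ := hd1 w h3
        exact ((hc.2 z hz).2.1 h1).trans ((he.2 z hz).1.1 h2)
      · intro h
        obtain ⟨w, h1, h2, h3⟩ := hS.rolle Q h hc.1.2 he.1.2
        obtain ⟨z, hz, rfl⟩ := hd2 w h3
        exact ((hc.2 z hz).2.2 h1).trans ((he.2 z hz).1.2 h2)
    exact ⟨key a ha' b hb', key b hb' a ha'⟩
  have hsubT : Z₂ ⊆ Z₂ ∪ T := Finset.subset_union_left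
  refine ⟨Z₂ ∪ T, hm, ?_, fun pq hpq => (hF₀ pq hpq).mono ((hZ₁.trans hZ₂).trans hsubT)⟩
  refine sameSigns_of_roots_matched hR hS hm (fun a ha => ?_) (fun w hw => ?_) (fun w hw => ?_)
    (fun w hw => ?_) ⟨lo, hsubT hlo, hlo1⟩ ⟨hi, hsubT (hZ₂ hhi), hhi1⟩
  · rcases Finset.mem_union.1 ha with ha | ha
    · exact hs a ha
    · rw [hmemT] at ha
      rw [ha.1.1, ha.1.2, sign_zero, sign_zero]
  · obtain ⟨a, ha, h⟩ := hd1 w hw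
    exact ⟨a, hsubT ha, h⟩
  · obtain ⟨v, hv, hpos⟩ := exists_root_samePos hR hS hm₂ hs hd1 ⟨lo, hlo, hlo2⟩
      ⟨hi, hZ₂ hhi, hhi2⟩ hw
    exact ⟨(w, v), Finset.mem_union_right _ ((hmemT _).2 ⟨⟨hw, hv⟩, hpos⟩), rfl⟩
  · have hsw : ∀ {b : R × S}, b ∈ Z₂ → b.swap ∈ swapPairs Z₂ := fun hb =>
      mem_swapPairs.2 (by simpa using hb)
    obtain ⟨v, hv, hpos⟩ := exists_root_samePos hS hR hm₂.swap
      (fun a ha => (hs a.swap (mem_swapPairs.1 ha)).symm)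
      (fun x hx => by
        obtain ⟨b, hb, h⟩ := hd2 x hx
        exact ⟨b.swap, hsw hb, h⟩)
      ⟨lo.swap, hsw hlo, hlo3⟩ ⟨hi.swap, hsw (hZ₂ hhi), hhi3⟩ hw
    exact ⟨(v, w), Finset.mem_union_right _ ((hmemT _).2 ⟨⟨hv, hw⟩, samePos_swap.1 hpos⟩), rfl⟩

end SignDiagramStep

/-! ### Transfer of sign conditions to the real numbers -/

/-- Division with remainder in one variable after multiplication by a power of the leading
coefficient of the divisor. -/
theorem exists_pseudo_remainder {A : Type*} [CommRing A] [IsDomain A] (q : Polynomial A)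
    (hq : q ≠ 0) (p : Polynomial A) :
    ∃ (k : ℕ) (s r : Polynomial A),
      Polynomial.C (q.leadingCoeff ^ k) * p = q * s + r ∧ r.degree < q.degree := by
  induction hd : p.degree using WellFoundedLT.induction generalizing p with
  | ind d ih =>
  by_cases hlt : p.degree < q.degree
  · exact ⟨0, 0, p, by simp, hlt⟩
  have hqlc : q.leadingCoeff ≠ 0 := Polynomial.leadingCoeff_ne_zero.2 hq
  have hp : p ≠ 0 := by
    rintro rfl
    exact hlt (by simpa [bot_lt_iff_ne_bot] using hq)
  have hplc : p.leadingCoeff ≠ 0 := Polynomial.leadingCoeff_ne_zero.2 hp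
  have hle : q.natDegree ≤ p.natDegree := Polynomial.natDegree_le_natDegree (not_lt.1 hlt)
  set t : Polynomial A := Polynomial.C p.leadingCoeff * Polynomial.X ^ (p.natDegree - q.natDegree)
    with ht
  have ht0 : t ≠ 0 := mul_ne_zero (by simpa using hp) (pow_ne_zero _ Polynomial.X_ne_zero)
  have hlt' : (Polynomial.C q.leadingCoeff * p - q * t).degree < p.degree := by
    have h1 : (Polynomial.C q.leadingCoeff * p).degree = p.degree := Polynomial.degree_C_mul hqlc
    rw [← h1]
    refine Polynomial.degree_sub_lt_left ?_ (mul_ne_zero (by simpa using hq) hp) ?_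
    · rw [h1, Polynomial.degree_mul, ht, Polynomial.degree_C_mul hplc, Polynomial.degree_X_pow,
        Polynomial.degree_eq_natDegree hp, Polynomial.degree_eq_natDegree hq]
      norm_cast
      omega
    · rw [Polynomial.leadingCoeff_mul, Polynomial.leadingCoeff_mul, ht,
        Polynomial.leadingCoeff_mul]
      simp
  obtain ⟨k, s, r, h, hr⟩ := ih _ (hd ▸ hlt') _ rfl
  refine ⟨k + 1, Polynomial.C (q.leadingCoeff ^ k) * t + s, r, ?_, hr⟩
  rw [pow_succ, map_mul]
  linear_combination h

section Transfer

variable {A R S : Type*} [CommRing A]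
  [Field R] [LinearOrder R] [IsStrictOrderedRing R]
  [Field S] [LinearOrder S] [IsStrictOrderedRing S]

/-- The homomorphisms `φ` and `ψ` give the same sign to every element of `Q`. -/
def AgreeOn (φ : A →+* R) (ψ : A →+* S) (Q : Finset A) : Prop :=
  ∀ c ∈ Q, SignType.sign (φ c) = SignType.sign (ψ c)

theorem AgreeOn.mono {φ : A →+* R} {ψ : A →+* S} {Q Q' : Finset A} (h : AgreeOn φ ψ Q')
    (hQ : Q ⊆ Q') : AgreeOn φ ψ Q := fun c hc => h c (hQ hc)

theorem AgreeOn.eq_zero_iff {φ : A →+* R} {ψ : A →+* S} {Q : Finset A} (h : AgreeOn φ ψ Q)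
    {c : A} (hc : c ∈ Q) : φ c = 0 ↔ ψ c = 0 := by
  rw [← sign_eq_zero_iff, h c hc, sign_eq_zero_iff]

theorem map_eraseLead_eq {B : Type*} [CommRing B] (ψ : A →+* B) (q : Polynomial A)
    (h : ψ q.leadingCoeff = 0) : q.eraseLead.map ψ = q.map ψ := by
  have e := congrArg (Polynomial.map ψ) (Polynomial.eraseLead_add_C_mul_X_pow q)
  rw [Polynomial.map_add, Polynomial.map_mul, Polynomial.map_C, h, map_zero, zero_mul,
    add_zero] at e
  exact e

/-- A polynomial may be replaced by one whose leading coefficient does not vanish under `φ`, as far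
as its images under `φ` and under homomorphisms with the same signs are concerned. -/
theorem exists_truncation (S : Type*) [Field S] [LinearOrder S] [IsStrictOrderedRing S]
    (φ : A →+* R) (q : Polynomial A) :
    ∃ (t : Polynomial A) (Q : Finset A), t.degree ≤ q.degree ∧ (t = 0 ∨ φ t.leadingCoeff ≠ 0) ∧
      t.map φ = q.map φ ∧ ∀ ψ : A →+* S, AgreeOn φ ψ Q → t.map ψ = q.map ψ := by
  classical
  induction hd : q.degree using WellFoundedLT.induction generalizing q with
  | ind d ih =>
  by_cases hq : q = 0
  · exact ⟨0, ∅, by simp, Or.inl rfl, by simp [hq], fun _ _ => by simp [hq]⟩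
  by_cases hlc : φ q.leadingCoeff = 0
  · have hlt := Polynomial.degree_eraseLead_lt hq
    obtain ⟨t, Q, h1, h2, h3, h4⟩ := ih _ (hd ▸ hlt) q.eraseLead rfl
    refine ⟨t, insert q.leadingCoeff Q, hd ▸ h1.trans hlt.le, h2,
      h3.trans (map_eraseLead_eq φ q hlc), fun ψ hψ => ?_⟩
    rw [h4 ψ (hψ.mono (Finset.subset_insert _ _)), map_eraseLead_eq ψ q]
    have := hψ _ (Finset.mem_insert_self _ _)
    rwa [hlc, sign_zero, eq_comm, sign_eq_zero_iff] at this
  · exact ⟨q, ∅, hd.le, Or.inr hlc, rfl, fun _ _ => rfl⟩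

theorem sign_eval_map_pseudo_remainder {p q t s r : Polynomial A} {k : ℕ}
    (h : Polynomial.C (t.leadingCoeff ^ k) * p = t * s + r) (χ : A →+* S)
    (hχ : χ t.leadingCoeff ≠ 0) (he : t.map χ = q.map χ) {x : S} (hx : (q.map χ).eval x = 0) :
    SignType.sign ((p.map χ).eval x) =
      SignType.sign (((Polynomial.C (t.leadingCoeff ^ k) * r).map χ).eval x) := by
  have e := congrArg (fun z : Polynomial A => (z.map χ).eval x) h
  simp only [Polynomial.map_mul, Polynomial.map_add, Polynomial.map_C, Polynomial.eval_mul,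
    Polynomial.eval_add, Polynomial.eval_C, he, hx, zero_mul, zero_add] at e
  rw [Polynomial.map_mul, Polynomial.map_C, Polynomial.eval_mul, Polynomial.eval_C, ← e,
    ← mul_assoc, sign_mul, map_pow, sign_pos (mul_self_pos.2 (pow_ne_zero k hχ)), one_mul]

/-- At the roots of the image of `q`, the sign of the image of `p` is that of the image of a
polynomial of degree less than that of `q`. -/
theorem exists_sign_remainder [IsDomain A] (S : Type*) [Field S] [LinearOrder S]
    [IsStrictOrderedRing S] (φ : A →+* R) (p q : Polynomial A) (hq : q.map φ ≠ 0) :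
    ∃ (r : Polynomial A) (Q : Finset A), r.degree < q.degree ∧
      (∀ x, (q.map φ).eval x = 0 →
        SignType.sign ((p.map φ).eval x) = SignType.sign ((r.map φ).eval x)) ∧
      ∀ ψ : A →+* S, AgreeOn φ ψ Q → ∀ x, (q.map ψ).eval x = 0 →
        SignType.sign ((p.map ψ).eval x) = SignType.sign ((r.map ψ).eval x) := by
  classical
  obtain ⟨t, Q, h1, h2, h3, h4⟩ := exists_truncation S φ q
  have ht : t ≠ 0 := by
    rintro rfl
    exact hq (by rw [← h3, Polynomial.map_zero])
  have hlc : φ t.leadingCoeff ≠ 0 := h2.resolve_left ht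
  obtain ⟨k, s, r, h5, h6⟩ := exists_pseudo_remainder t ht p
  have hdeg : (Polynomial.C (t.leadingCoeff ^ k) * r).degree < q.degree := by
    rw [Polynomial.degree_C_mul (pow_ne_zero k (Polynomial.leadingCoeff_ne_zero.2 ht))]
    exact h6.trans_le h1
  refine ⟨_, insert t.leadingCoeff Q, hdeg,
    fun x hx => sign_eval_map_pseudo_remainder h5 φ hlc h3 hx, fun ψ hψ x hx => ?_⟩
  refine sign_eval_map_pseudo_remainder h5 ψ (fun h => hlc ?_)
    (h4 ψ (hψ.mono (Finset.subset_insert _ _))) hx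
  exact (hψ.eq_zero_iff (Finset.mem_insert_self _ _)).2 h

/-- The signs of finitely many coefficients determine the sign diagram of the images of the family
`L` of polynomials. -/
def IsSignDetermined (S : Type*) [Field S] [LinearOrder S] (φ : A →+* R)
    (L : List (Polynomial A)) : Prop :=
  ∃ Q : Finset A, ∀ ψ : A →+* S, AgreeOn φ ψ Q →
    ∃ Z : Finset (R × S), IsMatching Z ∧ ∀ p ∈ L, SameSigns Z (p.map φ) (p.map ψ)

theorem IsSignDetermined.mono {φ : A →+* R} {L L' : List (Polynomial A)}
    (h : IsSignDetermined S φ L') (hL : ∀ p ∈ L, p ∈ L') : IsSignDetermined S φ L := by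
  obtain ⟨Q, hQ⟩ := h
  refine ⟨Q, fun ψ hψ => ?_⟩
  obtain ⟨Z, hZ, hs⟩ := hQ ψ hψ
  exact ⟨Z, hZ, fun p hp => hs p (hL p hp)⟩

theorem derivative_map_ne_zero (χ : A →+* S) {p : Polynomial A} (hχ : χ p.leadingCoeff ≠ 0)
    (hdeg : p.natDegree ≠ 0) : (p.map χ).derivative ≠ 0 := by
  rwa [Ne, Polynomial.derivative_eq_zero, Polynomial.natDegree_map_of_leadingCoeff_ne_zero χ hχ]

/-- Adjoining to a family a polynomial whose derivative and whose remainders modulo the family are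
already accounted for. -/
theorem IsSignDetermined.adjoin (hR : HasPolyIVT R) (hS : HasPolyIVT S)
    {φ : A →+* R} {L : List (Polynomial A)} {p : Polynomial A}
    (hlc : φ p.leadingCoeff ≠ 0) (hdeg : p.natDegree ≠ 0) (hD : p.derivative ∈ L)
    (rem : Polynomial A → Polynomial A) (Qr : Polynomial A → Finset A)
    (hrem : ∀ q ∈ L, q.map φ ≠ 0 → (∀ x, (q.map φ).eval x = 0 →
        SignType.sign ((p.map φ).eval x) = SignType.sign (((rem q).map φ).eval x)) ∧
      ∀ ψ : A →+* S, AgreeOn φ ψ (Qr q) → ∀ x, (q.map ψ).eval x = 0 →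
        SignType.sign ((p.map ψ).eval x) = SignType.sign (((rem q).map ψ).eval x))
    (h : IsSignDetermined S φ (L ++ L.map rem)) : IsSignDetermined S φ (p :: L) := by
  classical
  obtain ⟨Q, hQ⟩ := h
  refine ⟨insert p.leadingCoeff (Q ∪ L.toFinset.biUnion Qr), fun ψ hψ => ?_⟩
  obtain ⟨Z, hZ, hs⟩ := hQ ψ (hψ.mono (Finset.subset_union_left.trans (Finset.subset_insert _ _)))
  have hψlc : ψ p.leadingCoeff ≠ 0 := fun h0 =>
    hlc ((hψ.eq_zero_iff (Finset.mem_insert_self _ _)).2 h0)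
  obtain ⟨Z', hZ', h1, h2⟩ := exists_matching_adjoin hR hS hZ
    {pq | ∃ q ∈ L, pq = (q.map φ, q.map ψ)} (by
      rintro _ ⟨q, hq, rfl⟩
      exact hs q (List.mem_append_left _ hq))
    (p.map φ) (p.map ψ) ⟨_, hD, by simp [Polynomial.derivative_map]⟩
    (derivative_map_ne_zero φ hlc hdeg) (derivative_map_ne_zero ψ hψlc hdeg)
    (by rw [Polynomial.natDegree_map_of_leadingCoeff_ne_zero φ hlc,
      Polynomial.natDegree_map_of_leadingCoeff_ne_zero ψ hψlc])
    (by
      rw [Polynomial.leadingCoeff_map_of_leadingCoeff_ne_zero φ hlc,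
        Polynomial.leadingCoeff_map_of_leadingCoeff_ne_zero ψ hψlc]
      exact hψ _ (Finset.mem_insert_self _ _))
    (by
      rintro _ ⟨q, hq, rfl⟩ hq0 a ha hqa
      obtain ⟨h3, h4⟩ := hrem q hq hq0
      have hqa' : (q.map ψ).eval a.2 = 0 := by
        rw [← sign_eq_zero_iff, ← hs q (List.mem_append_left _ hq) _ _ (hZ a ha), sign_eq_zero_iff]
        exact hqa
      have hψ' : AgreeOn φ ψ (Qr q) := hψ.mono (((Finset.subset_biUnion_of_mem Qr
        (List.mem_toFinset.2 hq)).trans Finset.subset_union_right).trans (Finset.subset_insert _ _))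
      rw [h3 a.1 hqa, h4 ψ hψ' a.2 hqa']
      exact hs _ (List.mem_append_right _ (List.mem_map_of_mem hq)) _ _ (hZ a ha))
  refine ⟨Z', hZ', fun q hq => ?_⟩
  rcases List.mem_cons.1 hq with rfl | hq
  · exact h1
  · exact h2 _ ⟨q, hq, rfl⟩

theorem degree_le_of_degree_lt_succ {p : Polynomial A} {d : ℕ} (h : p.degree < (d + 1 : ℕ)) :
    p.degree ≤ d := by
  by_cases hp : p = 0
  · simp [hp]
  · rw [Polynomial.degree_eq_natDegree hp] at h ⊢
    exact_mod_cast Nat.lt_succ_iff.1 (by exact_mod_cast h)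

/-- The sign diagram of every finite family is determined by finitely many coefficients. The
induction is on a bound for the degrees and, below it, on the number of members that attain it;
one of these is adjoined after its derivative and its remainders, which have smaller degree. -/
theorem isSignDetermined [IsDomain A] (hR : HasPolyIVT R) (hS : HasPolyIVT S) (φ : A →+* R)
    (L : List (Polynomial A)) : IsSignDetermined S φ L := by
  classical
  suffices H : ∀ (d : ℕ) (L : List (Polynomial A)), (∀ p ∈ L, p.degree < d) →
      IsSignDetermined S φ L by
    obtain ⟨d, hd⟩ : ∃ d : ℕ, ∀ p ∈ L, p.natDegree < d :=
      ⟨(L.map Polynomial.natDegree).sum + 1, fun p hp =>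
        Nat.lt_succ_of_le (List.single_le_sum (by simp) _ (List.mem_map_of_mem hp))⟩
    exact H d L fun p hp => (Polynomial.degree_le_natDegree).trans_lt (by exact_mod_cast hd p hp)
  intro d
  induction d with
  | zero =>
    intro L hL
    refine ⟨∅, fun ψ _ => ⟨∅, by simp [IsMatching], fun p hp => ?_⟩⟩
    have : p = 0 := by simpa using hL p hp
    intro u v _
    simp [this]
  | succ d ih =>
  suffices H : ∀ T : List (Polynomial A), (∀ p ∈ T, p.degree < (d + 1 : ℕ)) →
      ∀ Lw : List (Polynomial A), (∀ p ∈ Lw, p.degree < d) → IsSignDetermined S φ (T ++ Lw) by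
    intro L hL
    simpa using H L hL [] (by simp)
  intro T
  induction T with
  | nil => exact fun _ Lw hLw => ih Lw hLw
  | cons p T ihT =>
  intro hT Lw hLw
  have hT' : ∀ q ∈ T, q.degree < (d + 1 : ℕ) := fun q hq => hT q (List.mem_cons_of_mem _ hq)
  by_cases hpd : p.degree < d
  · refine (ihT hT' (p :: Lw) ?_).mono ?_
    · simpa [hpd] using hLw
    · intro q
      simp only [List.cons_append, List.mem_cons, List.mem_append]
      tauto
  have hpd' : p.degree = d := by
    refine le_antisymm ?_ (not_lt.1 hpd)
    exact degree_le_of_degree_lt_succ (hT p List.mem_cons_self)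
  have hp0 : p ≠ 0 := by
    rintro rfl
    simp at hpd'
  by_cases hlc : φ p.leadingCoeff = 0
  · have hlt : p.eraseLead.degree < d := hpd' ▸ Polynomial.degree_eraseLead_lt hp0
    obtain ⟨Q, hQ⟩ := ihT hT' (p.eraseLead :: Lw) (by simpa [hlt] using hLw)
    refine ⟨insert p.leadingCoeff Q, fun ψ hψ => ?_⟩
    obtain ⟨Z, hZ, hs⟩ := hQ ψ (hψ.mono (Finset.subset_insert _ _))
    refine ⟨Z, hZ, fun q hq => ?_⟩
    rcases List.mem_cons.1 (List.cons_append ▸ hq) with rfl | hq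
    · rw [← map_eraseLead_eq φ q hlc, ← map_eraseLead_eq ψ q
        ((hψ.eq_zero_iff (Finset.mem_insert_self _ _)).1 hlc)]
      exact hs _ (by simp)
    · refine hs q ?_
      simp only [List.mem_cons, List.mem_append] at hq ⊢
      tauto
  by_cases hd0 : d = 0
  · obtain ⟨Q, hQ⟩ := ihT hT' Lw hLw
    refine ⟨insert (p.coeff 0) Q, fun ψ hψ => ?_⟩
    obtain ⟨Z, hZ, hs⟩ := hQ ψ (hψ.mono (Finset.subset_insert _ _))
    refine ⟨Z, hZ, fun q hq => ?_⟩
    rcases List.mem_cons.1 (List.cons_append ▸ hq) with rfl | hq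
    · intro u v _
      have hc := Polynomial.eq_C_of_degree_le_zero (p := q) (by rw [hpd', hd0]; simp)
      rw [hc]
      simpa using hψ _ (Finset.mem_insert_self _ _)
    · exact hs q hq
  have hDd : p.derivative.degree < d := hpd' ▸ Polynomial.degree_derivative_lt hp0
  have hex : ∀ q : Polynomial A, ∃ (r : Polynomial A) (Q : Finset A),
      (q.degree ≤ d → r.degree < d) ∧ (q.map φ ≠ 0 → (∀ x, (q.map φ).eval x = 0 →
        SignType.sign ((p.map φ).eval x) = SignType.sign ((r.map φ).eval x)) ∧
      ∀ ψ : A →+* S, AgreeOn φ ψ Q → ∀ x, (q.map ψ).eval x = 0 →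
        SignType.sign ((p.map ψ).eval x) = SignType.sign ((r.map ψ).eval x)) := by
    intro q
    by_cases hq : q.map φ = 0
    · exact ⟨0, ∅, fun _ => by simp, fun h => absurd hq h⟩
    · obtain ⟨r, Q, h1, h2⟩ := exists_sign_remainder S φ p q hq
      exact ⟨r, Q, fun h => h1.trans_le h, fun _ => h2⟩
  choose rem Qr hrd hrem using hex
  set L₀ : List (Polynomial A) := T ++ p.derivative :: Lw with hL₀
  have hL₀d : ∀ q ∈ L₀, q.degree ≤ d := by
    intro q hq
    rw [hL₀, List.mem_append, List.mem_cons] at hq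
    rcases hq with hq | rfl | hq
    · exact degree_le_of_degree_lt_succ (hT' q hq)
    · exact hDd.le
    · exact (hLw q hq).le
  have hgood : IsSignDetermined S φ (T ++ (p.derivative :: Lw ++ L₀.map rem)) := by
    refine ihT hT' _ fun q hq => ?_
    rw [List.mem_append, List.mem_cons, List.mem_map] at hq
    rcases hq with (rfl | hq) | ⟨q', hq', rfl⟩
    · exact hDd
    · exact hLw q hq
    · exact hrd q' (hL₀d q' hq')
  rw [← List.append_assoc] at hgood
  refine (hgood.adjoin hR hS hlc (by rwa [Polynomial.natDegree_eq_of_degree_eq_some hpd'])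
    (by simp) rem Qr (fun q _ => hrem q)).mono fun q hq => ?_
  simp only [List.cons_append, List.mem_cons, List.mem_append] at hq ⊢
  tauto

end Transfer

section Real

variable {R : Type*} [Field R] [LinearOrder R] [IsStrictOrderedRing R] [Algebra ℝ R]

theorem sign_algebraMap_real (hmono : ∀ c : ℝ, 0 ≤ c → 0 ≤ algebraMap ℝ R c) (c : ℝ) :
    SignType.sign (algebraMap ℝ R c) = SignType.sign c := by
  have hpos : ∀ c : ℝ, 0 < c → 0 < algebraMap ℝ R c := fun c hc =>
    lt_of_le_of_ne (hmono c hc.le) ((map_ne_zero _).2 hc.ne').symm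
  rcases lt_trichotomy c 0 with h | rfl | h
  · have := hpos (-c) (neg_pos.2 h)
    rw [map_neg, neg_pos] at this
    rw [sign_neg h, sign_neg this]
  · simp
  · rw [sign_pos h, sign_pos (hpos c h)]

/-- Tarski transfer: a sign condition on finitely many real polynomials that is satisfied at a point
over an ordered extension field with the intermediate value property is satisfied at a real
point. -/
theorem exists_real_point (hR : HasPolyIVT R) (hmono : ∀ c : ℝ, 0 ≤ c → 0 ≤ algebraMap ℝ R c)
    {n : ℕ} (L : Finset (MvPolynomial (Fin n) ℝ)) (a : Fin n → R) :
    ∃ b : Fin n → ℝ, ∀ p ∈ L, SignType.sign (aeval a p) = SignType.sign (eval b p) := by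
  classical
  induction n with
  | zero =>
    refine ⟨Fin.elim0, fun p _ => ?_⟩
    rw [MvPolynomial.eq_C_of_isEmpty p, ← MvPolynomial.algebraMap_eq, AlgHom.commutes,
      MvPolynomial.algebraMap_eq, eval_C]
    exact sign_algebraMap_real hmono _
  | succ n ih =>
    -- The last `n` coordinates are replaced first, preserving the coefficients that determine the
    -- sign diagram in the first variable.
    set φ : MvPolynomial (Fin n) ℝ →+* R := (aeval fun i => a i.succ : _ →ₐ[ℝ] R).toRingHom
    obtain ⟨Q, hQ⟩ := isSignDetermined hR hasPolyIVT_real φ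
      (L.toList.map fun p => finSuccEquiv ℝ n p)
    obtain ⟨b, hb⟩ := ih Q fun i => a i.succ
    obtain ⟨Z, hZ, hs⟩ := hQ (eval b) hb
    obtain ⟨y, hy⟩ := hZ.exists_samePos (a 0)
    refine ⟨Fin.cons y b, fun p hp => ?_⟩
    have h1 := hs (finSuccEquiv ℝ n p)
      (List.mem_map_of_mem (Finset.mem_toList.2 hp)) _ _ hy
    have h2 : ((finSuccEquiv ℝ n p).map φ).eval (a 0) = aeval a p := by
      have : ((Polynomial.eval₂RingHom φ (a 0)).comp
          (finSuccEquiv ℝ n).toRingEquiv.toRingHom) = (aeval a : _ →ₐ[ℝ] R).toRingHom := by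
        refine MvPolynomial.ringHom_ext (fun c => ?_) fun i => ?_
        · simp [φ, finSuccEquiv_apply]
        · refine Fin.cases ?_ (fun j => ?_) i
          · simp [finSuccEquiv_X_zero]
          · simp [finSuccEquiv_X_succ, φ]
      rw [Polynomial.eval_map]
      exact DFunLike.congr_fun this p
    rw [← h2, h1, MvPolynomial.eval_eq_eval_mv_eval']

end Real

/-! ### Real closed extensions of ordered fields -/

section SignChange

variable {R : Type*} [Field R] [LinearOrder R] [IsStrictOrderedRing R]

theorem exists_irreducible_dvd_of_sign_change (p : Polynomial R) {a b : R}
    (h : p.eval a * p.eval b < 0) :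
    ∃ f : Polynomial R, Irreducible f ∧ f ∣ p ∧ f.eval a * f.eval b < 0 := by
  induction p using WfDvdMonoid.induction_on_irreducible with
  | zero => simp at h
  | unit u hu =>
    obtain ⟨c, -, rfl⟩ := Polynomial.isUnit_iff.1 hu
    simp only [Polynomial.eval_C] at h
    exact absurd h (not_lt.2 (mul_self_nonneg c))
  | mul q i hq hi ih =>
    by_cases hcase : i.eval a * i.eval b < 0
    · exact ⟨i, hi, dvd_mul_right i q, hcase⟩
    · have : q.eval a * q.eval b < 0 := by
        by_contra hcon
        have := mul_nonneg (not_lt.1 hcase) (not_lt.1 hcon)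
        rw [Polynomial.eval_mul, Polynomial.eval_mul] at h
        linarith
      obtain ⟨f, h1, h2, h3⟩ := ih this
      exact ⟨f, h1, h2.mul_left i, h3⟩

/-- The sums of squares of polynomials with nonnegative weights from the field of coefficients. -/
noncomputable def weightedSumSq (R : Type*) [Field R] [LinearOrder R] :
    AddSubmonoid (Polynomial R) :=
  AddSubmonoid.closure {q | ∃ c : R, 0 ≤ c ∧ ∃ h : Polynomial R, q = Polynomial.C c * h ^ 2}

theorem eval_nonneg_of_mem_weightedSumSq {q : Polynomial R} (hq : q ∈ weightedSumSq R) (x : R) :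
    0 ≤ q.eval x := by
  induction hq using AddSubmonoid.closure_induction with
  | mem q hq =>
    obtain ⟨c, hc, h, rfl⟩ := hq
    rw [Polynomial.eval_mul, Polynomial.eval_C, Polynomial.eval_pow]
    positivity
  | zero => simp
  | add p q _ _ hp hq => rw [Polynomial.eval_add]; exact add_nonneg hp hq

/-- Reduction modulo `f` lowers the degree of a weighted sum of squares to at most
`2 * (deg f - 1)`. -/
theorem exists_reduction_weightedSumSq {f : Polynomial R} (hf : f.natDegree ≠ 0)
    {q : Polynomial R} (hq : q ∈ weightedSumSq R) :
    ∃ q' ∈ weightedSumSq R, f ∣ q - q' ∧ q'.natDegree ≤ 2 * (f.natDegree - 1) := by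
  induction hq using AddSubmonoid.closure_induction with
  | mem q hq =>
    obtain ⟨c, hc, h, rfl⟩ := hq
    refine ⟨Polynomial.C c * (h % f) ^ 2, AddSubmonoid.subset_closure ⟨c, hc, _, rfl⟩, ?_, ?_⟩
    · have e : h = f * (h / f) + h % f := (EuclideanDomain.div_add_mod h f).symm
      refine ⟨Polynomial.C c * (h / f) * (h + h % f), ?_⟩
      linear_combination (Polynomial.C c * (h + h % f)) * e
    · refine (Polynomial.natDegree_C_mul_le _ _).trans ?_
      refine Polynomial.natDegree_pow_le.trans (Nat.mul_le_mul_left 2 ?_)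
      exact Nat.le_sub_one_of_lt (Polynomial.natDegree_mod_lt h hf)
  | zero => exact ⟨0, zero_mem _, by simp, by simp⟩
  | add p q _ _ hp hq =>
    obtain ⟨p', h1, h2, h3⟩ := hp
    obtain ⟨q', h4, h5, h6⟩ := hq
    refine ⟨p' + q', add_mem h1 h4, ?_, Polynomial.natDegree_add_le_of_degree_le h3 h6⟩
    rw [add_sub_add_comm]
    exact dvd_add h2 h5

/-- Modulo an irreducible polynomial that changes sign, `-1` is not a weighted sum of squares. The
quotient in such an identity would have smaller degree and would again change sign. -/
theorem not_dvd_one_add_weightedSumSq {f : Polynomial R} (hf : Irreducible f) {a b : R}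
    (hab : f.eval a * f.eval b < 0) {q : Polynomial R} (hq : q ∈ weightedSumSq R) :
    ¬ f ∣ 1 + q := by
  induction hn : f.natDegree using Nat.strong_induction_on generalizing f q with
  | _ n ih =>
  intro hdvd
  have hf0 : f.natDegree ≠ 0 := hf.natDegree_pos.ne'
  obtain ⟨q', hq', h1, h2⟩ := exists_reduction_weightedSumSq hf0 hq
  obtain ⟨g, hg⟩ : f ∣ 1 + q' := by
    have := dvd_sub hdvd h1
    rwa [show 1 + q - (q - q') = 1 + q' by ring] at this
  have hpos : ∀ x, 0 < f.eval x * g.eval x := by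
    intro x
    have := congrArg (Polynomial.eval x) hg
    rw [Polynomial.eval_mul, Polynomial.eval_add, Polynomial.eval_one] at this
    rw [← this]
    have := eval_nonneg_of_mem_weightedSumSq hq' x
    linarith
  have hg0 : g ≠ 0 := by
    rintro rfl
    simpa using hpos 0
  have hdeg : g.natDegree < n := by
    have h3 : (f * g).natDegree ≤ 2 * (f.natDegree - 1) := by
      rw [← hg]
      refine (Polynomial.natDegree_add_le_of_degree_le ?_ h2)
      simp
    rw [Polynomial.natDegree_mul hf.ne_zero hg0] at h3
    omega
  have hgab : g.eval a * g.eval b < 0 := by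
    have h4 := mul_pos (hpos a) (hpos b)
    by_contra hcon
    have := mul_nonpos_of_nonpos_of_nonneg hab.le (not_lt.1 hcon)
    nlinarith
  obtain ⟨f', h5, h6, h7⟩ := exists_irreducible_dvd_of_sign_change g hgab
  exact ih _ ((Polynomial.natDegree_le_of_dvd h6 hg0).trans_lt hdeg) h5 h7 hq' rfl
    (h6.trans ⟨f, by rw [hg, mul_comm]⟩)

end SignChange

section Precone

variable {Ω : Type*} [Field Ω]

/-- `P` is a preordering of the subfield `P - P` of `Ω`: a set of elements closed under addition,
multiplication and inversion that contains the squares of the elements of `P - P` but not `-1`. -/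
structure IsPrecone (P : Set Ω) : Prop where
  add : ∀ x ∈ P, ∀ y ∈ P, x + y ∈ P
  mul : ∀ x ∈ P, ∀ y ∈ P, x * y ∈ P
  one : 1 ∈ P
  sq : ∀ x ∈ P, ∀ y ∈ P, (x - y) ^ 2 ∈ P
  inv : ∀ x ∈ P, x⁻¹ ∈ P
  neg_one_notMem : -1 ∉ P

namespace IsPrecone

variable {P : Set Ω}

theorem zero (hP : IsPrecone P) : 0 ∈ P := by
  simpa using hP.sq 1 hP.one 1 hP.one

theorem eq_zero (hP : IsPrecone P) {x : Ω} (hx : x ∈ P) (hx' : -x ∈ P) : x = 0 := by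
  by_contra h0
  refine hP.neg_one_notMem ?_
  have := hP.mul _ hx' _ (hP.inv x hx)
  rwa [neg_mul, mul_inv_cancel₀ h0] at this

/-- The field of differences of the elements of a precone. -/
def subfield (hP : IsPrecone P) : Subfield Ω where
  carrier := {x | ∃ a ∈ P, ∃ b ∈ P, x = a - b}
  zero_mem' := ⟨0, hP.zero, 0, hP.zero, by simp⟩
  one_mem' := ⟨1, hP.one, 0, hP.zero, by simp⟩
  add_mem' := by
    rintro _ _ ⟨a, ha, b, hb, rfl⟩ ⟨c, hc, d, hd, rfl⟩
    exact ⟨a + c, hP.add a ha c hc, b + d, hP.add b hb d hd, by ring⟩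
  neg_mem' := by
    rintro _ ⟨a, ha, b, hb, rfl⟩
    exact ⟨b, hb, a, ha, by ring⟩
  mul_mem' := by
    rintro _ _ ⟨a, ha, b, hb, rfl⟩ ⟨c, hc, d, hd, rfl⟩
    exact ⟨a * c + b * d, hP.add _ (hP.mul a ha c hc) _ (hP.mul b hb d hd),
      a * d + b * c, hP.add _ (hP.mul a ha d hd) _ (hP.mul b hb c hc), by ring⟩
  inv_mem' := by
    rintro _ ⟨a, ha, b, hb, rfl⟩
    have h := hP.inv _ (hP.sq a ha b hb)
    refine ⟨a * ((a - b) ^ 2)⁻¹, hP.mul _ ha _ h, b * ((a - b) ^ 2)⁻¹, hP.mul _ hb _ h, ?_⟩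
    rw [← sub_mul]
    by_cases h0 : a - b = 0
    · simp [h0]
    · field_simp

theorem mem_subfield_of_mem (hP : IsPrecone P) {x : Ω} (hx : x ∈ P) : x ∈ hP.subfield :=
  ⟨x, hx, 0, hP.zero, by simp⟩

theorem sq_mem_of_mem_subfield (hP : IsPrecone P) {x : Ω} (hx : x ∈ hP.subfield) : x ^ 2 ∈ P := by
  obtain ⟨a, ha, b, hb, rfl⟩ := hx
  exact hP.sq a ha b hb

/-- A set between a precone and an extension field closed under addition and multiplication that
contains the squares of that field is a precone as soon as it omits `-1`. -/
theorem of_squares {T : Set Ω} (E : Subfield Ω) (hTE : T ⊆ E) (hsq : ∀ x ∈ E, x ^ 2 ∈ T)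
    (hadd : ∀ x ∈ T, ∀ y ∈ T, x + y ∈ T) (hmul : ∀ x ∈ T, ∀ y ∈ T, x * y ∈ T)
    (hneg : -1 ∉ T) : IsPrecone T where
  add := hadd
  mul := hmul
  one := by simpa using hsq 1 E.one_mem
  sq x hx y hy := hsq _ (sub_mem (hTE hx) (hTE hy))
  inv x hx := by
    have h := hmul _ hx _ (hsq _ (inv_mem (hTE hx)))
    by_cases h0 : x = 0
    · simpa [h0] using h
    · rwa [show x * x⁻¹ ^ 2 = x⁻¹ by field_simp] at h
  neg_one_notMem := hneg

theorem exists_maximal (hP : IsPrecone P) : ∃ M, P ⊆ M ∧ Maximal IsPrecone M := by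
  refine zorn_subset_nonempty {Q : Set Ω | IsPrecone Q} (fun c hc hchain hne => ?_) P hP
  obtain ⟨Q₀, hQ₀⟩ := hne
  have key : ∀ x ∈ ⋃₀ c, ∀ y ∈ ⋃₀ c, ∃ Q ∈ c, x ∈ Q ∧ y ∈ Q := by
    rintro x ⟨Q, hQ, hx⟩ y ⟨Q', hQ', hy⟩
    rcases hchain.total hQ hQ' with h | h
    · exact ⟨Q', hQ', h hx, hy⟩
    · exact ⟨Q, hQ, hx, h hy⟩
  refine ⟨⋃₀ c, ⟨?_, ?_, ⟨Q₀, hQ₀, (hc hQ₀).one⟩, ?_, ?_, ?_⟩, fun Q hQ =>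
    Set.subset_sUnion_of_mem hQ⟩
  · intro x hx y hy
    obtain ⟨Q, hQ, h1, h2⟩ := key x hx y hy
    exact ⟨Q, hQ, (hc hQ).add x h1 y h2⟩
  · intro x hx y hy
    obtain ⟨Q, hQ, h1, h2⟩ := key x hx y hy
    exact ⟨Q, hQ, (hc hQ).mul x h1 y h2⟩
  · intro x hx y hy
    obtain ⟨Q, hQ, h1, h2⟩ := key x hx y hy
    exact ⟨Q, hQ, (hc hQ).sq x h1 y h2⟩
  · rintro x ⟨Q, hQ, h⟩
    exact ⟨Q, hQ, (hc hQ).inv x h⟩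
  · rintro ⟨Q, hQ, h⟩
    exact (hc hQ).neg_one_notMem h

/-- A maximal precone is a (total) ordering of its field of differences. -/
theorem mem_or_neg_mem (hP : Maximal IsPrecone P) {x : Ω} (hx : x ∈ hP.prop.subfield) :
    x ∈ P ∨ -x ∈ P := by
  have hC := hP.prop
  by_contra! hcon
  set T : Set Ω := {z | ∃ p ∈ P, ∃ q ∈ P, z = p - q * x} with hT
  have hPT : P ⊆ T := fun p hp => ⟨p, hp, 0, hC.zero, by simp⟩
  have hxT : -x ∈ T := ⟨0, hC.zero, 1, hC.one, by simp⟩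
  have hTC : IsPrecone T := by
    refine of_squares hC.subfield ?_ (fun y hy => hPT (hC.sq_mem_of_mem_subfield hy)) ?_ ?_ ?_
    · rintro _ ⟨p, hp, q, hq, rfl⟩
      exact sub_mem (hC.mem_subfield_of_mem hp) (mul_mem (hC.mem_subfield_of_mem hq) hx)
    · rintro _ ⟨p, hp, q, hq, rfl⟩ _ ⟨p', hp', q', hq', rfl⟩
      exact ⟨p + p', hC.add p hp p' hp', q + q', hC.add q hq q' hq', by ring⟩
    · rintro _ ⟨p, hp, q, hq, rfl⟩ _ ⟨p', hp', q', hq', rfl⟩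
      refine ⟨p * p' + q * q' * x ^ 2, hC.add _ (hC.mul p hp p' hp') _
        (hC.mul _ (hC.mul q hq q' hq') _ (hC.sq_mem_of_mem_subfield hx)),
        p * q' + q * p', hC.add _ (hC.mul p hp q' hq') _ (hC.mul q hq p' hp'), ?_⟩
      ring
    · rintro ⟨p, hp, q, hq, h⟩
      have hq0 : q ≠ 0 := by
        rintro rfl
        refine hC.neg_one_notMem ?_
        rw [h]
        simpa using hp
      refine hcon.1 ?_
      have : x = (1 + p) * q⁻¹ := by
        field_simp
        linear_combination h
      rw [this]
      exact hC.mul _ (hC.add _ hC.one _ hp) _ (hC.inv q hq)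
  exact hcon.2 (hP.le_of_ge hTC hPT hxT)

/-- The order on the field of differences of a maximal precone. -/
@[reducible] noncomputable def linearOrder (hP : Maximal IsPrecone P) :
    LinearOrder hP.prop.subfield where
  le x y := (y - x : Ω) ∈ P
  le_refl x := by simpa using hP.prop.zero
  le_trans x y z h1 h2 := by
    have := hP.prop.add _ h1 _ h2
    rwa [show (y - x : Ω) + (z - y) = z - x by ring] at this
  le_antisymm x y h1 h2 := by
    refine Subtype.ext (sub_eq_zero.1 (hP.prop.eq_zero h2 ?_))
    rwa [neg_sub]
  le_total x y := by
    rcases mem_or_neg_mem hP (sub_mem y.2 x.2) with h | h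
    · exact Or.inl h
    · refine Or.inr ?_
      rwa [neg_sub] at h
  toDecidableLE := Classical.decRel _

theorem isStrictOrderedRing (hP : Maximal IsPrecone P) :
    @IsStrictOrderedRing hP.prop.subfield _ (linearOrder hP).toPartialOrder := by
  let := linearOrder hP
  have hle : ∀ x y : hP.prop.subfield, x ≤ y ↔ (y - x : Ω) ∈ P := fun _ _ => Iff.rfl
  have : IsOrderedAddMonoid hP.prop.subfield :=
    { add_le_add_left := fun a b h c => by
        rw [hle] at h ⊢
        simpa using h }
  have : ZeroLEOneClass hP.prop.subfield := ⟨by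
    rw [hle]
    simpa using hP.prop.one⟩
  refine IsStrictOrderedRing.of_mul_pos fun a b ha hb => ?_
  refine lt_of_le_of_ne ?_ (mul_ne_zero ha.ne' hb.ne').symm
  have h1 := (hle 0 a).1 ha.le
  have h2 := (hle 0 b).1 hb.le
  rw [hle]
  simp only [ZeroMemClass.coe_zero, sub_zero] at h1 h2 ⊢
  simpa using hP.prop.mul _ h1 _ h2

/-- In an algebraically closed field, an irreducible polynomial over the ordered field of a maximal
precone that changes sign is linear: otherwise the ordering extends to the field generated by one
of its roots. -/
theorem degree_eq_one_of_sign_change [IsAlgClosed Ω] (hP : Maximal IsPrecone P)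
    (f : Polynomial hP.prop.subfield) (hf : Irreducible f) {a b : hP.prop.subfield}
    (hab : letI := linearOrder hP; f.eval a * f.eval b < 0) : f.degree = 1 := by
  let := linearOrder hP
  have := isStrictOrderedRing hP
  have hC := hP.prop
  obtain ⟨α, hα⟩ := IsAlgClosed.exists_aeval_eq_zero Ω f (by
    rw [Polynomial.degree_eq_natDegree hf.ne_zero]
    exact_mod_cast hf.natDegree_pos.ne')
  have hint : IsIntegral hC.subfield α :=
    (isAlgebraic_iff_isIntegral).1 ⟨f, hf.ne_zero, hα⟩
  set E : IntermediateField hC.subfield Ω := IntermediateField.adjoin hC.subfield {α} with hE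
  have hαE : α ∈ E := IntermediateField.mem_adjoin_simple_self _ α
  have hEpoly : ∀ y ∈ E, ∃ h : Polynomial hC.subfield, y = Polynomial.aeval α h := by
    intro y hy
    have h1 : y ∈ E.toSubalgebra := hy
    rw [hE, IntermediateField.adjoin_simple_toSubalgebra_of_isAlgebraic
      (isAlgebraic_iff_isIntegral.2 hint), Algebra.adjoin_singleton_eq_range_aeval] at h1
    obtain ⟨h, hh⟩ := h1
    exact ⟨h, hh.symm⟩
  set T : AddSubmonoid Ω := AddSubmonoid.closure {z | ∃ c ∈ P, ∃ y ∈ E, z = c * y ^ 2} with hT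
  have hPE : ∀ c ∈ P, c ∈ E := fun c hc =>
    E.algebraMap_mem ⟨c, hC.mem_subfield_of_mem hc⟩
  have hTE : ∀ z ∈ T, z ∈ E := by
    intro z hz
    induction hz using AddSubmonoid.closure_induction with
    | mem z hz =>
      obtain ⟨c, hc, y, hy, rfl⟩ := hz
      exact mul_mem (hPE c hc) (pow_mem hy 2)
    | zero => exact E.zero_mem
    | add x y _ _ hx hy => exact add_mem hx hy
  have hpoly : ∀ z ∈ T, ∃ q ∈ weightedSumSq hC.subfield, z = Polynomial.aeval α q := by
    intro z hz
    induction hz using AddSubmonoid.closure_induction with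
    | mem z hz =>
      obtain ⟨c, hc, y, hy, rfl⟩ := hz
      obtain ⟨h, rfl⟩ := hEpoly y hy
      refine ⟨Polynomial.C ⟨c, hC.mem_subfield_of_mem hc⟩ * h ^ 2, AddSubmonoid.subset_closure
        ⟨_, ?_, h, rfl⟩, ?_⟩
      · show (c - ((0 : hC.subfield) : Ω)) ∈ P
        simpa using hc
      · rw [map_mul, map_pow, Polynomial.aeval_C]
        rfl
    | zero => exact ⟨0, zero_mem _, by simp⟩
    | add x y _ _ hx hy =>
      obtain ⟨p, hp, rfl⟩ := hx
      obtain ⟨q, hq, rfl⟩ := hy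
      exact ⟨p + q, add_mem hp hq, by simp⟩
  have hsq : ∀ x ∈ E, x ^ 2 ∈ T := fun x hx =>
    AddSubmonoid.subset_closure ⟨1, hC.one, x, hx, by simp⟩
  have hTC : IsPrecone (T : Set Ω) := by
    refine of_squares E.toSubfield hTE hsq (fun x hx y hy => add_mem hx hy) ?_ ?_
    · intro x hx y hy
      rw [SetLike.mem_coe] at hx hy ⊢
      induction hx, hy using AddSubmonoid.closure_induction₂ with
      | mem x y hx hy =>
        obtain ⟨c, hc, u, hu, rfl⟩ := hx
        obtain ⟨d, hd, v, hv, rfl⟩ := hy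
        exact AddSubmonoid.subset_closure
          ⟨c * d, hC.mul c hc d hd, u * v, mul_mem hu hv, by ring⟩
      | zero_left => simp
      | zero_right => simp
      | add_left x y z _ _ _ h1 h2 => rw [add_mul]; exact add_mem h1 h2
      | add_right x y z _ _ _ h1 h2 => rw [mul_add]; exact add_mem h1 h2
    · intro hneg
      obtain ⟨q, hq, h⟩ := hpoly _ hneg
      refine not_dvd_one_add_weightedSumSq hf hab hq ?_
      have h0 : Polynomial.aeval α (1 + q) = 0 := by rw [map_add, ← h]; simp
      have h1 := minpoly.dvd hC.subfield α h0
      rw [← minpoly.eq_of_irreducible hf hα] at h1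
      exact (dvd_mul_right _ _).trans h1
  have hPT : P ⊆ T := fun c hc => AddSubmonoid.subset_closure ⟨c, hc, 1, E.one_mem, by simp⟩
  have hTP := hP.le_of_ge hTC hPT
  have h2 : (2 : Ω) ≠ 0 := by
    intro h
    refine hC.neg_one_notMem ?_
    rw [show (-1 : Ω) = 1 by linear_combination -h]
    exact hC.one
  have h2E : (2 : Ω)⁻¹ ∈ E := inv_mem (by exact_mod_cast E.natCast_mem 2)
  -- By maximality `T = P`, so `α = ((α + 1) / 2)² - ((α - 1) / 2)²` is a difference of elements
  -- of `P`.
  have hαK : α ∈ hC.subfield := by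
    refine ⟨_, hTP (hsq ((α + 1) * 2⁻¹) (mul_mem (add_mem hαE E.one_mem) h2E)), _,
      hTP (hsq ((α - 1) * 2⁻¹) (mul_mem (sub_mem hαE E.one_mem) h2E)), ?_⟩
    field_simp
    ring
  refine Polynomial.degree_eq_one_of_irreducible_of_root hf (x := ⟨α, hαK⟩) ?_
  refine Subtype.ext ?_
  refine Eq.trans ?_ hα
  exact (Polynomial.aeval_algebraMap_apply Ω (⟨α, hαK⟩ : hC.subfield) f).symm

/-- The field of differences of a maximal precone of an algebraically closed field is real
closed. -/
theorem hasPolyIVT [IsAlgClosed Ω] (hP : Maximal IsPrecone P) :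
    @HasPolyIVT hP.prop.subfield _ (linearOrder hP) := by
  let := linearOrder hP
  have := isStrictOrderedRing hP
  intro p a b hlt hab
  obtain ⟨f, hf, ⟨g, rfl⟩, hfab⟩ := exists_irreducible_dvd_of_sign_change p hab
  have hd := degree_eq_one_of_sign_change hP f hf hfab
  obtain ⟨c, d, hc, rfl⟩ : ∃ c d, c ≠ 0 ∧ f = Polynomial.C c * (Polynomial.X - Polynomial.C d) := by
    have h1 : f.coeff 1 ≠ 0 := Polynomial.coeff_ne_zero_of_eq_degree hd
    refine ⟨f.coeff 1, -(f.coeff 0 / f.coeff 1), h1, ?_⟩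
    rw [Polynomial.eq_X_add_C_of_degree_le_one hd.le]
    simp [mul_add, ← Polynomial.C_mul, mul_div_cancel₀ _ h1]
  simp only [Polynomial.eval_mul, Polynomial.eval_sub, Polynomial.eval_X, Polynomial.eval_C]
    at hfab
  have h1 : (a - d) * (b - d) < 0 := by
    have h2 : 0 < c * c := mul_self_pos.2 hc
    by_contra hcon
    have := mul_nonneg h2.le (not_lt.1 hcon)
    linarith
  rcases mul_neg_iff.1 h1 with h | h
  · linarith
  · exact ⟨d, sub_neg.1 h.1, sub_pos.1 h.2, by simp⟩

end IsPrecone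

end Precone

/-! ### Preorderings of polynomial rings -/

section Cone

variable {A : Type*} [CommRing A]

/-- A preordering, possibly improper: a set closed under addition and multiplication that contains
all squares. -/
structure IsCone (T : Set A) : Prop where
  add : ∀ x ∈ T, ∀ y ∈ T, x + y ∈ T
  mul : ∀ x ∈ T, ∀ y ∈ T, x * y ∈ T
  sq : ∀ x, x ^ 2 ∈ T

/-- The preordering generated by a preordering and one more element. -/
def adjoinCone (T : Set A) (w : A) : Set A := {z | ∃ s ∈ T, ∃ t ∈ T, z = s + w * t}

namespace IsCone

variable {T : Set A}

theorem zero (hT : IsCone T) : 0 ∈ T := by simpa using hT.sq 0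

theorem one (hT : IsCone T) : 1 ∈ T := by simpa using hT.sq 1

theorem subset_adjoinCone (hT : IsCone T) (w : A) : T ⊆ adjoinCone T w :=
  fun x hx => ⟨x, hx, 0, hT.zero, by simp⟩

theorem self_mem_adjoinCone (hT : IsCone T) (w : A) : w ∈ adjoinCone T w :=
  ⟨0, hT.zero, 1, hT.one, by simp⟩

theorem adjoin (hT : IsCone T) (w : A) : IsCone (adjoinCone T w) where
  add := by
    rintro _ ⟨a, ha, b, hb, rfl⟩ _ ⟨c, hc, d, hd, rfl⟩
    exact ⟨a + c, hT.add a ha c hc, b + d, hT.add b hb d hd, by ring⟩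
  mul := by
    rintro _ ⟨a, ha, b, hb, rfl⟩ _ ⟨c, hc, d, hd, rfl⟩
    exact ⟨a * c + w ^ 2 * (b * d), hT.add _ (hT.mul a ha c hc) _ (hT.mul _ (hT.sq w) _
      (hT.mul b hb d hd)), a * d + b * c, hT.add _ (hT.mul a ha d hd) _ (hT.mul b hb c hc), by ring⟩
  sq x := hT.subset_adjoinCone w (hT.sq x)

theorem exists_maximal (hT : IsCone T) (h1 : -1 ∉ T) :
    ∃ M, T ⊆ M ∧ Maximal (fun P : Set A => IsCone P ∧ -1 ∉ P) M := by
  refine zorn_subset_nonempty {Q : Set A | IsCone Q ∧ -1 ∉ Q} (fun c hc hchain hne => ?_) T ⟨hT, h1⟩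
  obtain ⟨Q₀, hQ₀⟩ := hne
  have key : ∀ x ∈ ⋃₀ c, ∀ y ∈ ⋃₀ c, ∃ Q ∈ c, x ∈ Q ∧ y ∈ Q := by
    rintro x ⟨Q, hQ, hx⟩ y ⟨Q', hQ', hy⟩
    rcases hchain.total hQ hQ' with h | h
    · exact ⟨Q', hQ', h hx, hy⟩
    · exact ⟨Q, hQ, hx, h hy⟩
  refine ⟨⋃₀ c, ⟨⟨?_, ?_, fun x => ⟨Q₀, hQ₀, (hc hQ₀).1.sq x⟩⟩, ?_⟩, fun Q hQ =>
    Set.subset_sUnion_of_mem hQ⟩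
  · intro x hx y hy
    obtain ⟨Q, hQ, h1, h2⟩ := key x hx y hy
    exact ⟨Q, hQ, (hc hQ).1.add x h1 y h2⟩
  · intro x hx y hy
    obtain ⟨Q, hQ, h1, h2⟩ := key x hx y hy
    exact ⟨Q, hQ, (hc hQ).1.mul x h1 y h2⟩
  · rintro ⟨Q, hQ, h⟩
    exact (hc hQ).2 h

variable {P : Set A}

theorem neg_one_mem_adjoinCone (hP : Maximal (fun P : Set A => IsCone P ∧ -1 ∉ P) P) {x : A}
    (hx : x ∉ P) : -1 ∈ adjoinCone P x := by
  by_contra h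
  exact hx (hP.le_of_ge ⟨hP.prop.1.adjoin x, h⟩ (hP.prop.1.subset_adjoinCone x)
    (hP.prop.1.self_mem_adjoinCone x))

theorem mem_or_neg_mem (hP : Maximal (fun P : Set A => IsCone P ∧ -1 ∉ P) P) (x : A) :
    x ∈ P ∨ -x ∈ P := by
  by_contra! hcon
  have hC := hP.prop.1
  obtain ⟨p, hp, q, hq, h1⟩ := neg_one_mem_adjoinCone hP hcon.1
  obtain ⟨p', hp', q', hq', h2⟩ := neg_one_mem_adjoinCone hP hcon.2
  refine hP.prop.2 ?_
  have e : (-1 : A) = p + p' + p * p' + q * q' * x ^ 2 := by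
    linear_combination (1 + p') * h1 - x * q * h2
  rw [e]
  exact hC.add _ (hC.add _ (hC.add _ hp _ hp') _ (hC.mul _ hp _ hp')) _
    (hC.mul _ (hC.mul _ hq _ hq') _ (hC.sq x))

/-- The support `P ∩ -P` of a maximal proper preordering. -/
def support (hP : Maximal (fun P : Set A => IsCone P ∧ -1 ∉ P) P) : Ideal A where
  carrier := {x | x ∈ P ∧ -x ∈ P}
  zero_mem' := ⟨hP.prop.1.zero, by simpa using hP.prop.1.zero⟩
  add_mem' := by
    rintro x y ⟨h1, h2⟩ ⟨h3, h4⟩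
    exact ⟨hP.prop.1.add x h1 y h3, by rw [neg_add]; exact hP.prop.1.add _ h2 _ h4⟩
  smul_mem' := by
    rintro a x ⟨h1, h2⟩
    rcases mem_or_neg_mem hP a with h | h
    · exact ⟨hP.prop.1.mul a h x h1, by simpa using hP.prop.1.mul a h _ h2⟩
    · exact ⟨by simpa using hP.prop.1.mul _ h _ h2, by simpa using hP.prop.1.mul _ h x h1⟩

/-- Outside the support, every element is, up to sign, a divisor of `1 + p` with `p ∈ P`. -/
theorem exists_mul_eq_one_add (hP : Maximal (fun P : Set A => IsCone P ∧ -1 ∉ P) P) {x : A}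
    (hx : x ∉ support hP) : ∃ q, ∃ p ∈ P, x * q = 1 + p := by
  by_cases h : x ∈ P
  · have h' : -x ∉ P := fun h' => hx ⟨h, h'⟩
    obtain ⟨p, hp, q, -, e⟩ := neg_one_mem_adjoinCone hP h'
    exact ⟨q, p, hp, by linear_combination e⟩
  · obtain ⟨p, hp, q, -, e⟩ := neg_one_mem_adjoinCone hP h
    exact ⟨-q, p, hp, by linear_combination e⟩

theorem one_add_notMem_support (hP : Maximal (fun P : Set A => IsCone P ∧ -1 ∉ P) P) {p : A}
    (hp : p ∈ P) : 1 + p ∉ support hP := fun h =>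
  hP.prop.2 (by simpa using hP.prop.1.add _ hp _ h.2)

theorem isPrime_support (hP : Maximal (fun P : Set A => IsCone P ∧ -1 ∉ P) P) :
    (support hP).IsPrime := by
  have hC := hP.prop.1
  refine Ideal.isPrime_iff.2 ⟨fun h => ?_, fun {x y} hxy => ?_⟩
  · refine one_add_notMem_support hP hC.zero ?_
    rw [h]
    trivial
  · by_contra! hcon
    obtain ⟨q, p, hp, e⟩ := exists_mul_eq_one_add hP hcon.1
    obtain ⟨q', p', hp', e'⟩ := exists_mul_eq_one_add hP hcon.2
    have h1 := Ideal.mul_mem_left _ (q * q') hxy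
    rw [show q * q' * (x * y) = 1 + (p + p' + p * p') by linear_combination y * q' * e +
      (1 + p) * e'] at h1
    exact one_add_notMem_support hP (hC.add _ (hC.add _ hp _ hp') _ (hC.mul _ hp _ hp')) h1

/-- The quotients of elements of `P` by nonzero squares form a precone of any field that contains
the quotient ring by the support of `P`. -/
theorem isPrecone_fractions {Ω : Type*} [Field Ω]
    (hP : Maximal (fun P : Set A => IsCone P ∧ -1 ∉ P) P) (ι : A →+* Ω)
    (hι : ∀ a, ι a = 0 ↔ a ∈ support hP) :
    IsPrecone {z : Ω | ∃ a ∈ P, ∃ b, ι b ≠ 0 ∧ z = ι a / ι b ^ 2} := by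
  have hC := hP.prop.1
  refine ⟨?_, ?_, ?_, ?_, ?_, ?_⟩
  · rintro _ ⟨a, ha, b, hb, rfl⟩ _ ⟨c, hc, d, hd, rfl⟩
    refine ⟨a * d ^ 2 + c * b ^ 2, hC.add _ (hC.mul _ ha _ (hC.sq d)) _ (hC.mul _ hc _ (hC.sq b)),
      b * d, ?_, ?_⟩
    · rw [map_mul]
      exact mul_ne_zero hb hd
    · simp only [map_add, map_mul, map_pow]
      field_simp
  · rintro _ ⟨a, ha, b, hb, rfl⟩ _ ⟨c, hc, d, hd, rfl⟩
    refine ⟨a * c, hC.mul _ ha _ hc, b * d, ?_, ?_⟩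
    · rw [map_mul]
      exact mul_ne_zero hb hd
    · simp only [map_mul]
      field_simp
  · exact ⟨1, hC.one, 1, by simp, by simp⟩
  · rintro _ ⟨a, ha, b, hb, rfl⟩ _ ⟨c, hc, d, hd, rfl⟩
    refine ⟨(a * d ^ 2 - c * b ^ 2) ^ 2, hC.sq _, b ^ 2 * d ^ 2, ?_, ?_⟩
    · rw [map_mul, map_pow, map_pow]
      exact mul_ne_zero (pow_ne_zero 2 hb) (pow_ne_zero 2 hd)
    · simp only [map_sub, map_mul, map_pow]
      field_simp
  · rintro _ ⟨a, ha, b, hb, rfl⟩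
    by_cases ha0 : ι a = 0
    · exact ⟨0, hC.zero, 1, by simp, by simp [ha0]⟩
    · refine ⟨a * b ^ 2, hC.mul _ ha _ (hC.sq b), a, ha0, ?_⟩
      simp only [map_mul, map_pow]
      field_simp
  · rintro ⟨a, ha, b, hb, h⟩
    have h2 : ι (b ^ 2 + a) = 0 := by
      rw [map_add, map_pow]
      field_simp at h
      linear_combination -h
    have h3 := hι _ |>.1 h2
    refine hb ((hι b).2 ((isPrime_support hP).mem_of_pow_mem 2 ⟨hC.sq b, ?_⟩))
    simpa using hC.add _ h3.2 _ ha

universe u in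
/-- A proper preordering is the preimage of a subset of the nonnegative elements under some
homomorphism to an ordered field with the intermediate value property. -/
theorem exists_ringHom_nonneg {A : Type u} [CommRing A] {T : Set A} (hT : IsCone T) (h1 : -1 ∉ T) :
    ∃ (R : Type u) (_ : Field R) (_ : LinearOrder R) (_ : IsStrictOrderedRing R) (φ : A →+* R),
      HasPolyIVT R ∧ ∀ x ∈ T, 0 ≤ φ x := by
  obtain ⟨P, hTP, hP⟩ := hT.exists_maximal h1
  have hC := hP.prop.1
  have := isPrime_support hP
  let Ω := AlgebraicClosure (FractionRing (A ⧸ support hP))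
  let ι : A →+* Ω := ((algebraMap (FractionRing (A ⧸ support hP)) Ω).comp
    (algebraMap (A ⧸ support hP) (FractionRing (A ⧸ support hP)))).comp
      (Ideal.Quotient.mk (support hP))
  have hι : ∀ a, ι a = 0 ↔ a ∈ support hP := by
    intro a
    rw [← Ideal.Quotient.eq_zero_iff_mem]
    simp only [ι, RingHom.comp_apply]
    rw [map_eq_zero, FaithfulSMul.algebraMap_eq_zero_iff]
  have hS := isPrecone_fractions hP ι hι
  obtain ⟨M, hSM, hM⟩ := hS.exists_maximal
  have hmem : ∀ x ∈ P, ι x ∈ M := fun x hx => hSM ⟨x, hx, 1, by simp, by simp⟩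
  refine ⟨hM.prop.subfield, inferInstance, IsPrecone.linearOrder hM,
    IsPrecone.isStrictOrderedRing hM, ι.codRestrict hM.prop.subfield fun x => ?_,
    IsPrecone.hasPolyIVT hM, fun x hx => ?_⟩
  · rcases mem_or_neg_mem hP x with h | h
    · exact hM.prop.mem_subfield_of_mem (hmem x h)
    · have := neg_mem (hM.prop.mem_subfield_of_mem (hmem _ h))
      rwa [map_neg, neg_neg] at this
  · show (ι x - ((0 : hM.prop.subfield) : Ω)) ∈ M
    simpa using hmem x (hTP hx)

end IsCone

end Cone

/-- Finitely many elements of a proper preordering of a real polynomial ring have a common point of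
nonnegativity. -/
theorem IsCone.exists_forall_eval_nonneg {n : ℕ} {T : Set (MvPolynomial (Fin n) ℝ)} (hT : IsCone T)
    (h1 : -1 ∉ T) (L : Finset (MvPolynomial (Fin n) ℝ)) (hL : ∀ p ∈ L, p ∈ T) :
    ∃ b : Fin n → ℝ, ∀ p ∈ L, 0 ≤ eval b p := by
  obtain ⟨R, _, _, _, φ, hR, hφ⟩ := hT.exists_ringHom_nonneg h1
  let := (φ.comp C).toAlgebra
  have halg : ∀ c : ℝ, algebraMap ℝ R c = φ (C c) := fun _ => rfl
  obtain ⟨b, hb⟩ := exists_real_point hR (fun c hc => by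
    rw [halg]
    have := hφ _ (hT.sq (C (Real.sqrt c)))
    rwa [← map_pow, Real.sq_sqrt hc] at this) L (fun i => φ (X i))
  refine ⟨b, fun p hp => ?_⟩
  have h2 : aeval (fun i => φ (X i)) p = φ p := by
    have : (aeval (fun i => φ (X i)) : _ →ₐ[ℝ] R).toRingHom = φ :=
      MvPolynomial.ringHom_ext (fun c => by simp [halg]) (fun i => by simp)
    exact DFunLike.congr_fun this p
  have h3 := hb p hp
  rw [h2] at h3
  rw [← sign_nonneg_iff, ← h3, sign_nonneg_iff]
  exact hφ p (hL p hp)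

/-! ### Archimedean quadratic modules -/

section QuadraticModule

variable {A : Type*} [CommRing A] [Algebra ℝ A]

/-- A quadratic module, possibly improper: a set closed under addition and under multiplication by
squares that contains `1`. -/
structure IsQuadraticModule (M : Set A) : Prop where
  add : ∀ x ∈ M, ∀ y ∈ M, x + y ∈ M
  one : 1 ∈ M
  sq_mul : ∀ a, ∀ x ∈ M, a ^ 2 * x ∈ M

/-- Every element is bounded above by a real constant modulo `M`. -/
def IsArchimedean (M : Set A) : Prop := ∀ a : A, ∃ c : ℝ, algebraMap ℝ A c - a ∈ M

theorem IsArchimedean.mono {M N : Set A} (h : IsArchimedean M) (hMN : M ⊆ N) : IsArchimedean N :=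
  fun a => (h a).imp fun _ hc => hMN hc

theorem IsCone.isQuadraticModule {T : Set A} (hT : IsCone T) : IsQuadraticModule T :=
  ⟨hT.add, hT.one, fun a x hx => hT.mul _ (hT.sq a) x hx⟩

namespace IsQuadraticModule

variable {M : Set A}

theorem sq (hM : IsQuadraticModule M) (a : A) : a ^ 2 ∈ M := by simpa using hM.sq_mul a 1 hM.one

theorem zero (hM : IsQuadraticModule M) : 0 ∈ M := by simpa using hM.sq 0

theorem real_mul (hM : IsQuadraticModule M) {c : ℝ} (hc : 0 ≤ c) {x : A} (hx : x ∈ M) :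
    algebraMap ℝ A c * x ∈ M := by
  have := hM.sq_mul (algebraMap ℝ A (Real.sqrt c)) x hx
  rwa [← map_pow, Real.sq_sqrt hc] at this

theorem real_mem (hM : IsQuadraticModule M) {c : ℝ} (hc : 0 ≤ c) : algebraMap ℝ A c ∈ M := by
  simpa using hM.real_mul hc hM.one

theorem sumSq_mul (hM : IsQuadraticModule M) {s : A} (hs : IsSumSq s) {x : A} (hx : x ∈ M) :
    s * x ∈ M := by
  induction hs with
  | zero => simpa using hM.zero
  | sq_add a _ ih =>
    rw [add_mul]
    refine hM.add _ ?_ _ ih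
    simpa [pow_two] using hM.sq_mul a x hx

theorem sumSq_mem (hM : IsQuadraticModule M) {s : A} (hs : IsSumSq s) : s ∈ M := by
  simpa using hM.sumSq_mul hs hM.one

theorem neg_real_notMem (hM : IsQuadraticModule M) (h1 : -1 ∉ M) {c : ℝ} (hc : c < 0) :
    algebraMap ℝ A c ∉ M := fun h => by
  have h2 := hM.real_mul (c := (-c)⁻¹) (by rw [inv_nonneg]; linarith) h
  rw [← map_mul, show (-c)⁻¹ * c = -1 by rw [inv_neg, neg_mul, inv_mul_cancel₀ hc.ne], map_neg,
    map_one] at h2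
  exact h1 h2

/-- The quadratic module generated by a quadratic module and one more element. -/
theorem adjoin (hM : IsQuadraticModule M) (x : A) :
    IsQuadraticModule {z | ∃ q ∈ M, ∃ s, IsSumSq s ∧ z = q + x * s} where
  add := by
    rintro _ ⟨q, hq, s, hs, rfl⟩ _ ⟨q', hq', s', hs', rfl⟩
    exact ⟨q + q', hM.add q hq q' hq', s + s', hs.add hs', by ring⟩
  one := ⟨1, hM.one, 0, IsSumSq.zero, by simp⟩
  sq_mul := by
    rintro a _ ⟨q, hq, s, hs, rfl⟩
    refine ⟨a ^ 2 * q, hM.sq_mul a q hq, a ^ 2 * s, IsSumSq.mul ?_ hs, by ring⟩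
    rw [pow_two]
    exact IsSumSq.mul_self a

theorem subset_adjoin (x : A) : M ⊆ {z | ∃ q ∈ M, ∃ s, IsSumSq s ∧ z = q + x * s} :=
  fun q hq => ⟨q, hq, 0, IsSumSq.zero, by simp⟩

theorem self_mem_adjoin (hM : IsQuadraticModule M) (x : A) :
    x ∈ {z | ∃ q ∈ M, ∃ s, IsSumSq s ∧ z = q + x * s} :=
  ⟨0, hM.zero, 1, IsSumSq.one, by simp⟩

theorem exists_maximal (hM : IsQuadraticModule M) (h1 : -1 ∉ M) :
    ∃ Q, M ⊆ Q ∧ Maximal (fun Q : Set A => IsQuadraticModule Q ∧ -1 ∉ Q) Q := by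
  refine zorn_subset_nonempty {Q : Set A | IsQuadraticModule Q ∧ -1 ∉ Q}
    (fun c hc hchain hne => ?_) M ⟨hM, h1⟩
  obtain ⟨Q₀, hQ₀⟩ := hne
  refine ⟨⋃₀ c, ⟨⟨?_, ⟨Q₀, hQ₀, (hc hQ₀).1.one⟩, ?_⟩, ?_⟩, fun Q hQ =>
    Set.subset_sUnion_of_mem hQ⟩
  · rintro x ⟨Q, hQ, hx⟩ y ⟨Q', hQ', hy⟩
    rcases hchain.total hQ hQ' with h | h
    · exact ⟨Q', hQ', (hc hQ').1.add x (h hx) y hy⟩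
    · exact ⟨Q, hQ, (hc hQ).1.add x hx y (h hy)⟩
  · rintro a x ⟨Q, hQ, hx⟩
    exact ⟨Q, hQ, (hc hQ).1.sq_mul a x hx⟩
  · rintro ⟨Q, hQ, h⟩
    exact (hc hQ).2 h

/-- Multiplication by an arbitrary element preserves the support `M ∩ -M`, since every element is a
difference of two squares. -/
theorem mul_mem_of_mem_support (hM : IsQuadraticModule M) {x : A} (h1 : x ∈ M) (h2 : -x ∈ M)
    (a : A) : a * x ∈ M := by
  have h3 := hM.add _ (hM.sq_mul (algebraMap ℝ A 2⁻¹ * (a + 1)) x h1) _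
    (hM.sq_mul (algebraMap ℝ A 2⁻¹ * (a - 1)) (-x) h2)
  have e : (algebraMap ℝ A 2⁻¹) * 2 = 1 := by
    rw [← map_ofNat (algebraMap ℝ A) 2, ← map_mul]
    norm_num
  convert h3 using 1
  linear_combination (-(a * x) * (algebraMap ℝ A 2⁻¹ * 2 + 1)) * e

/-- A maximal proper quadratic module is total. -/
theorem mem_or_neg_mem {Q : Set A}
    (hQ : Maximal (fun Q : Set A => IsQuadraticModule Q ∧ -1 ∉ Q) Q) (x : A) :
    x ∈ Q ∨ -x ∈ Q := by
  by_contra! hcon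
  have hM := hQ.prop.1
  have key : ∀ y, y ∉ Q → ∃ q ∈ Q, ∃ s, IsSumSq s ∧ -1 = q + y * s := by
    intro y hy
    by_contra h
    exact hy (hQ.le_of_ge ⟨hM.adjoin y, h⟩ (subset_adjoin y) (hM.self_mem_adjoin y))
  obtain ⟨q, hq, s, hs, e⟩ := key x hcon.1
  obtain ⟨q', hq', s', hs', e'⟩ := key (-x) hcon.2
  -- The multiplier `s` lies in the support, hence so does `x * s`.
  have hneg : -s ∈ Q := by
    have e2 : -s = s' + s * q' + s' * q := by linear_combination s' * e + s * e'
    rw [e2]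
    exact hM.add _ (hM.add _ (hM.sumSq_mem hs') _ (hM.sumSq_mul hs hq')) _ (hM.sumSq_mul hs' hq)
  refine hQ.prop.2 ?_
  rw [e]
  exact hM.add _ hq _ (hM.mul_mem_of_mem_support (hM.sumSq_mem hs) hneg x)

/-- Modulo `M`, the element `a` differs from the real number `r` by an infinitesimal. -/
def IsNear (M : Set A) (a : A) (r : ℝ) : Prop :=
  ∀ ε : ℝ, 0 < ε → algebraMap ℝ A (r + ε) - a ∈ M ∧ a - algebraMap ℝ A (r - ε) ∈ M

theorem isNear_algebraMap (hM : IsQuadraticModule M) (c : ℝ) : IsNear M (algebraMap ℝ A c) c :=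
  fun ε hε => ⟨by rw [← map_sub]; exact hM.real_mem (by linarith),
    by rw [← map_sub]; exact hM.real_mem (by linarith)⟩

theorem IsNear.add (hM : IsQuadraticModule M) {a b : A} {r s : ℝ} (ha : IsNear M a r)
    (hb : IsNear M b s) : IsNear M (a + b) (r + s) := fun ε hε => by
  obtain ⟨h1, h2⟩ := ha (ε / 2) (half_pos hε)
  obtain ⟨h3, h4⟩ := hb (ε / 2) (half_pos hε)
  constructor
  · convert hM.add _ h1 _ h3 using 1
    rw [show r + s + ε = (r + ε / 2) + (s + ε / 2) by ring, map_add]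
    ring
  · convert hM.add _ h2 _ h4 using 1
    rw [show r + s - ε = (r - ε / 2) + (s - ε / 2) by ring, map_add]
    ring

theorem IsNear.neg {a : A} {r : ℝ} (ha : IsNear M a r) : IsNear M (-a) (-r) := fun ε hε => by
  obtain ⟨h1, h2⟩ := ha ε hε
  constructor
  · convert h2 using 1
    rw [show -r + ε = -(r - ε) by ring, map_neg]
    ring
  · convert h1 using 1
    rw [show -r - ε = -(r + ε) by ring, map_neg]
    ring

theorem IsNear.real_mul (hM : IsQuadraticModule M) {a : A} {r : ℝ} (ha : IsNear M a r) (c : ℝ) :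
    IsNear M (algebraMap ℝ A c * a) (c * r) := by
  have hpos : ∀ c : ℝ, 0 < c → IsNear M (algebraMap ℝ A c * a) (c * r) := fun c hc ε hε => by
    obtain ⟨h1, h2⟩ := ha (ε / c) (div_pos hε hc)
    have h3 := hM.real_mul hc.le h1
    have h4 := hM.real_mul hc.le h2
    rw [mul_sub, ← map_mul] at h3 h4
    rw [show c * (r + ε / c) = c * r + ε by field_simp] at h3
    rw [show c * (r - ε / c) = c * r - ε by field_simp] at h4
    exact ⟨h3, h4⟩
  rcases lt_trichotomy c 0 with h | rfl | h
  · have := (hpos (-c) (neg_pos.2 h)).neg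
    simpa using this
  · simpa using hM.isNear_algebraMap 0
  · exact hpos c h

/-- If `-ε ≤ a ≤ ε` modulo `M` then `a ^ 2 ≤ ε ^ 2` modulo `M`. -/
theorem sq_sub_sq_mem (hM : IsQuadraticModule M) {a : A} {ε : ℝ} (hε : 0 < ε)
    (h1 : algebraMap ℝ A ε - a ∈ M) (h2 : algebraMap ℝ A ε + a ∈ M) :
    algebraMap ℝ A (ε ^ 2) - a ^ 2 ∈ M := by
  have h3 := hM.real_mul (c := (2 * ε)⁻¹) (by positivity) (hM.add _ (hM.sq_mul
    (algebraMap ℝ A ε - a) _ h2) _ (hM.sq_mul (algebraMap ℝ A ε + a) _ h1))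
  have e : algebraMap ℝ A (2 * ε)⁻¹ * (2 * algebraMap ℝ A ε) = 1 := by
    rw [← map_ofNat (algebraMap ℝ A) 2, ← map_mul, ← map_mul, inv_mul_cancel₀ (by positivity),
      map_one]
  convert h3 using 1
  rw [map_pow]
  linear_combination (-((algebraMap ℝ A ε) ^ 2 - a ^ 2)) * e

theorem IsNear.sq (hM : IsQuadraticModule M) {a : A} {r : ℝ} (ha : IsNear M a r) :
    IsNear M (a ^ 2) (r ^ 2) := by
  have hb : IsNear M (a + algebraMap ℝ A (-r)) 0 := by
    simpa using IsNear.add hM ha (hM.isNear_algebraMap (-r))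
  have hb2 : IsNear M ((a + algebraMap ℝ A (-r)) ^ 2) 0 := fun δ hδ => by
    obtain ⟨h1, h2⟩ := hb (Real.sqrt δ) (Real.sqrt_pos.2 hδ)
    constructor
    · rw [zero_add] at h1 ⊢
      have := hM.sq_sub_sq_mem (Real.sqrt_pos.2 hδ) h1 (by
        convert h2 using 1
        simp only [zero_sub, map_neg]
        ring)
      rwa [Real.sq_sqrt hδ.le] at this
    · rw [zero_sub, map_neg _ δ, sub_neg_eq_add]
      exact hM.add _ (hM.sq _) _ (hM.real_mem hδ.le)
  have := IsNear.add hM (IsNear.add hM hb2 (IsNear.real_mul hM ha (2 * r)))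
    (hM.isNear_algebraMap (-r ^ 2))
  convert this using 1
  · simp only [map_neg, map_mul, map_pow, map_ofNat]
    ring
  · ring

theorem IsNear.mul (hM : IsQuadraticModule M) {a b : A} {r s : ℝ} (ha : IsNear M a r)
    (hb : IsNear M b s) : IsNear M (a * b) (r * s) := by
  have h1 := IsNear.sq hM (IsNear.add hM ha hb)
  have h2 := IsNear.sq hM (IsNear.add hM ha hb.neg)
  have h3 := IsNear.real_mul hM (IsNear.add hM h1 h2.neg) 4⁻¹
  have e : (algebraMap ℝ A 4⁻¹) * 4 = 1 := by
    rw [← map_ofNat (algebraMap ℝ A) 4, ← map_mul]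
    norm_num
  convert h3 using 1
  · linear_combination (-(a * b)) * e
  · ring

theorem IsNear.unique (hM : IsQuadraticModule M) (h1 : -1 ∉ M) {a : A} {r s : ℝ}
    (hr : IsNear M a r) (hs : IsNear M a s) : r = s := by
  have key : ∀ r s : ℝ, IsNear M a r → IsNear M a s → ¬ r < s := fun r s hr hs hlt => by
    have h2 := hM.add _ (hr ((s - r) / 3) (by linarith)).1 _ (hs ((s - r) / 3) (by linarith)).2
    rw [sub_add_sub_cancel, ← map_sub] at h2
    exact hM.neg_real_notMem h1 (by linarith) h2
  exact le_antisymm (not_lt.1 (key s r hs hr)) (not_lt.1 (key r s hr hs))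

theorem IsNear.nonneg (hM : IsQuadraticModule M) (h1 : -1 ∉ M) {a : A} {r : ℝ}
    (hr : IsNear M a r) (ha : a ∈ M) : 0 ≤ r := by
  by_contra! hlt
  have h2 := hM.add _ (hr (-r / 2) (by linarith)).1 _ ha
  rw [sub_add_cancel] at h2
  exact hM.neg_real_notMem h1 (by linarith) h2

theorem exists_isNear {Q : Set A} (hQ : Maximal (fun Q : Set A => IsQuadraticModule Q ∧ -1 ∉ Q) Q)
    (hA : IsArchimedean Q) (a : A) : ∃ r, IsNear Q a r := by
  have hM := hQ.prop.1
  -- The real number is the infimum of the upper bounds of `a` modulo `Q`.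
  set S : Set ℝ := {c | algebraMap ℝ A c - a ∈ Q} with hS
  have hne : S.Nonempty := hA a
  obtain ⟨d, hd⟩ := hA (-a)
  have hbdd : BddBelow S := ⟨-d, fun c hc => by
    by_contra! hlt
    have h2 := hM.add _ hc _ hd
    rw [show algebraMap ℝ A c - a + (algebraMap ℝ A d - -a) = algebraMap ℝ A (c + d) by
      rw [map_add]; ring] at h2
    exact hM.neg_real_notMem hQ.prop.2 (by linarith) h2⟩
  refine ⟨sInf S, fun ε hε => ⟨?_, ?_⟩⟩
  · obtain ⟨c, hc, hlt⟩ := exists_lt_of_csInf_lt hne (lt_add_of_pos_right (sInf S) hε)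
    have h2 := hM.add _ hc _ (hM.real_mem (A := A) (c := sInf S + ε - c) (by linarith))
    convert h2 using 1
    rw [map_sub]
    ring
  · rcases mem_or_neg_mem hQ (a - algebraMap ℝ A (sInf S - ε)) with h | h
    · exact h
    · rw [neg_sub] at h
      have := csInf_le hbdd (show sInf S - ε ∈ S from h)
      linarith

/-- A proper archimedean quadratic module is nonnegative under some real character. -/
theorem exists_character (hM : IsQuadraticModule M) (hA : IsArchimedean M) (h1 : -1 ∉ M) :
    ∃ χ : A →ₐ[ℝ] ℝ, ∀ a ∈ M, 0 ≤ χ a := by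
  obtain ⟨Q, hMQ, hQ⟩ := hM.exists_maximal h1
  obtain ⟨hQM, hQ1⟩ := hQ.prop
  choose L hL using exists_isNear hQ (hA.mono hMQ)
  have huniq : ∀ {a r}, IsNear Q a r → L a = r := fun h => IsNear.unique hQM hQ1 (hL _) h
  have hconst : ∀ c : ℝ, L (algebraMap ℝ A c) = c := fun c => huniq (hQM.isNear_algebraMap c)
  refine ⟨{
    toFun := L
    map_one' := ?_
    map_mul' := ?_
    map_zero' := ?_
    map_add' := ?_
    commutes' := hconst }, fun a ha => IsNear.nonneg hQM hQ1 (hL a) (hMQ ha)⟩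
  · simpa using hconst 1
  · exact fun a b => huniq (IsNear.mul hQM (hL a) (hL b))
  · simpa using hconst 0
  · exact fun a b => huniq (IsNear.add hQM (hL a) (hL b))

/-- Lowering the constant `r` in `f + r ∈ M`, given an identity `p * f = 1 + m` with `p` a sum of
squares and `m ∈ M`. -/
theorem add_real_mem_step (hM : IsQuadraticModule M) {f p m : A} (hp : IsSumSq p) (hm : m ∈ M)
    (hfp : f * p = 1 + m) {k : ℝ} (hk : 0 < k) (hk1 : algebraMap ℝ A (2 * k) - p ∈ M)
    (hk2 : algebraMap ℝ A (2 * k - 1) - p ^ 2 * f ∈ M) {r : ℝ} (hr : 0 ≤ r)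
    (hfr : f + algebraMap ℝ A r ∈ M) : f + algebraMap ℝ A (r - (k ^ 2)⁻¹) ∈ M := by
  set κ := algebraMap ℝ A k with hκ
  have e : algebraMap ℝ A (2 * k)⁻¹ * (2 * κ) = 1 := by
    rw [hκ, ← map_ofNat (algebraMap ℝ A) 2, ← map_mul, ← map_mul, inv_mul_cancel₀ (by positivity),
      map_one]
  have e2 : algebraMap ℝ A (k ^ 2)⁻¹ * κ ^ 2 = 1 := by
    rw [hκ, ← map_pow, ← map_mul, inv_mul_cancel₀ (by positivity), map_one]
  rw [map_mul, map_ofNat, ← hκ] at hk1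
  rw [map_sub, map_mul, map_ofNat, map_one, ← hκ] at hk2
  have h1 : p * (2 * κ - p) ∈ M := by
    have h := hM.real_mul (c := (2 * k)⁻¹) (by positivity) (hM.add _ (hM.sq_mul (2 * κ - p) _
      (hM.sumSq_mem hp)) _ (hM.sq_mul p _ hk1))
    convert h using 1
    linear_combination (-(p * (2 * κ - p))) * e
  have h2 := hM.add _ (hM.add _ (hM.add _ (hM.sq_mul (κ - p) _ hfr) _
    (hM.real_mul (c := 2 * k) (by positivity) hm)) _ (hM.real_mul hr h1)) _ hk2
  have h3 := hM.real_mul (c := (k ^ 2)⁻¹) (by positivity) h2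
  convert h3 using 1
  simp only [map_sub, map_mul, map_ofNat, ← hκ]
  linear_combination (-(f + algebraMap ℝ A r)) * e2 + 2 * κ * algebraMap ℝ A (k ^ 2)⁻¹ * hfp

/-- The archimedean Positivstellensatz: an element positive under all real characters that are
nonnegative on an archimedean quadratic module belongs to that module. -/
theorem mem_of_forall_character_pos (hM : IsQuadraticModule M) (hA : IsArchimedean M) {f : A}
    (hf : ∀ χ : A →ₐ[ℝ] ℝ, (∀ a ∈ M, 0 ≤ χ a) → 0 < χ f) : f ∈ M := by
  obtain ⟨m, hm, p, hp, e⟩ : ∃ q ∈ M, ∃ s, IsSumSq s ∧ -1 = q + -f * s := by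
    by_contra hcon
    obtain ⟨χ, hχ⟩ := (hM.adjoin (-f)).exists_character (hA.mono (subset_adjoin _)) hcon
    have h1 := hf χ fun a ha => hχ a (subset_adjoin _ ha)
    have h2 := hχ _ (hM.self_mem_adjoin (-f))
    rw [map_neg] at h2
    linarith
  have hfp : f * p = 1 + m := by linear_combination e
  obtain ⟨c₁, hc₁⟩ := hA p
  obtain ⟨c₂, hc₂⟩ := hA (p ^ 2 * f)
  obtain ⟨c₃, hc₃⟩ := hA (-f)
  have hup : ∀ {a : A} {c d : ℝ}, c ≤ d → algebraMap ℝ A c - a ∈ M → algebraMap ℝ A d - a ∈ M := by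
    intro a c d hcd h
    have := hM.add _ h _ (hM.real_mem (sub_nonneg.2 hcd))
    convert this using 1
    rw [map_sub]
    ring
  set k : ℝ := max 1 (max c₁ (c₂ + 1)) with hk
  have hk1 : 1 ≤ k := le_max_left _ _
  have hk2 : c₁ ≤ k := (le_max_left _ _).trans (le_max_right _ _)
  have hk3 : c₂ + 1 ≤ k := (le_max_right _ _).trans (le_max_right _ _)
  have hkpos : 0 < k := by linarith
  set δ : ℝ := (k ^ 2)⁻¹ with hδ
  have hδpos : 0 < δ := by positivity
  -- Each step lowers the constant by `δ`, until it reaches `0`.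
  have hind : ∀ j : ℕ, f + algebraMap ℝ A (max (c₃ - j * δ) 0) ∈ M := by
    intro j
    induction j with
    | zero =>
      have := hup (le_max_left c₃ 0) hc₃
      rw [sub_neg_eq_add, add_comm] at this
      simpa using this
    | succ j ih =>
      have h := hM.add_real_mem_step hp hm hfp hkpos (hup (by linarith) hc₁)
        (hup (by linarith) hc₂) (le_max_right _ _) ih
      have hle : max (c₃ - j * δ) 0 - δ ≤ max (c₃ - (j + 1 : ℕ) * δ) 0 := by
        rw [sub_le_iff_le_add]
        refine max_le ?_ ?_
        · have := le_max_left (c₃ - (j + 1 : ℕ) * δ) 0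
          push_cast at this ⊢
          linarith
        · have := le_max_right (c₃ - (j + 1 : ℕ) * δ) 0
          linarith
      have := hup (a := -f) hle (by rwa [sub_neg_eq_add, add_comm])
      rwa [sub_neg_eq_add, add_comm] at this
  obtain ⟨j, hj⟩ := exists_nat_gt (c₃ / δ)
  have := hind j
  rw [div_lt_iff₀ hδpos] at hj
  rw [max_eq_right (by linarith)] at this
  simpa using this

end IsQuadraticModule

end QuadraticModule

/-! ### Bounded elements and Putinar's theorem -/

section Bounded

variable {A : Type*} [CommRing A] [Algebra ℝ A]

theorem isCone_isSumSq : IsCone {s : A | IsSumSq s} where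
  add _ hx _ hy := hx.add hy
  mul _ hx _ hy := IsSumSq.mul hx hy
  sq x := by
    rw [pow_two]
    exact IsSumSq.mul_self x

/-- The element `a` is bounded by a real constant modulo `M`. -/
def IsBoundedMod (M : Set A) (a : A) : Prop :=
  ∃ c : ℝ, 0 < c ∧ algebraMap ℝ A c - a ∈ M ∧ algebraMap ℝ A c + a ∈ M

namespace IsQuadraticModule

variable {M : Set A}

theorem isBoundedMod_algebraMap (hM : IsQuadraticModule M) (c : ℝ) :
    IsBoundedMod M (algebraMap ℝ A c) := by
  refine ⟨|c| + 1, by positivity, ?_, ?_⟩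
  · rw [← map_sub]
    exact hM.real_mem (by linarith [le_abs_self c])
  · rw [← map_add]
    exact hM.real_mem (by linarith [neg_abs_le c])

theorem isBoundedMod_add (hM : IsQuadraticModule M) {a b : A} (ha : IsBoundedMod M a)
    (hb : IsBoundedMod M b) : IsBoundedMod M (a + b) := by
  obtain ⟨c, hc, h1, h2⟩ := ha
  obtain ⟨d, hd, h3, h4⟩ := hb
  refine ⟨c + d, add_pos hc hd, ?_, ?_⟩
  · convert hM.add _ h1 _ h3 using 1
    rw [map_add]
    ring
  · convert hM.add _ h2 _ h4 using 1
    rw [map_add]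
    ring

theorem isBoundedMod_neg {a : A} (ha : IsBoundedMod M a) : IsBoundedMod M (-a) := by
  obtain ⟨c, hc, h1, h2⟩ := ha
  exact ⟨c, hc, by rwa [sub_neg_eq_add], by rwa [← sub_eq_add_neg]⟩

theorem isBoundedMod_mul (hM : IsQuadraticModule M) {a b : A} (ha : IsBoundedMod M a)
    (hb : IsBoundedMod M b) : IsBoundedMod M (a * b) := by
  have hsq : ∀ {x : A}, IsBoundedMod M x → ∃ c : ℝ, 0 < c ∧ algebraMap ℝ A c - x ^ 2 ∈ M := by
    rintro x ⟨c, hc, h1, h2⟩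
    exact ⟨c ^ 2, by positivity, hM.sq_sub_sq_mem hc h1 h2⟩
  obtain ⟨c, hc, h1⟩ := hsq (hM.isBoundedMod_add ha hb)
  obtain ⟨d, hd, h2⟩ := hsq (hM.isBoundedMod_add ha (isBoundedMod_neg hb))
  have e : (algebraMap ℝ A 4⁻¹) * 4 = 1 := by
    rw [← map_ofNat (algebraMap ℝ A) 4, ← map_mul]
    norm_num
  refine ⟨4⁻¹ * (c + d), by positivity, ?_, ?_⟩
  · have h3 := hM.real_mul (c := 4⁻¹) (by norm_num) (hM.add _ (hM.add _ h1 _ (hM.sq (a + -b))) _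
      (hM.real_mem hd.le))
    convert h3 using 1
    rw [map_mul, map_add]
    linear_combination (a * b) * e
  · have h3 := hM.real_mul (c := 4⁻¹) (by norm_num) (hM.add _ (hM.add _ h2 _ (hM.sq (a + b))) _
      (hM.real_mem hc.le))
    convert h3 using 1
    rw [map_mul, map_add]
    linear_combination (-(a * b)) * e

end IsQuadraticModule

end Bounded

section PolynomialRing

variable {n : ℕ}

/-- A quadratic module of polynomials that contains the equation of a ball is archimedean. -/
theorem isArchimedean_of_ball {M : Set (MvPolynomial (Fin n) ℝ)} (hM : IsQuadraticModule M) {N : ℝ}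
    (hN : C N - ∑ i, X i ^ 2 ∈ M) : IsArchimedean M := by
  suffices H : ∀ p, IsBoundedMod M p from fun p => (H p).imp fun _ h => h.2.1
  have hX : ∀ i, IsBoundedMod M (X i) := by
    intro i
    have hN0 : C N - X i ^ 2 ∈ M := by
      have h : ∀ s : Finset (Fin n), ∑ j ∈ s, (X j : MvPolynomial (Fin n) ℝ) ^ 2 ∈ M := by
        intro s
        exact Finset.sum_induction _ (· ∈ M) (fun a b ha hb => hM.add a ha b hb) hM.zero
          fun j _ => hM.sq _
      have h2 := hM.add _ hN _ (h (Finset.univ.erase i))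
      rw [← Finset.add_sum_erase _ _ (Finset.mem_univ i)] at h2
      convert h2 using 1
      ring
    have e : (C 4⁻¹ : MvPolynomial (Fin n) ℝ) = C 2⁻¹ ^ 2 := by
      rw [← map_pow]
      norm_num
    have e1 : (2 : MvPolynomial (Fin n) ℝ) * C 2⁻¹ = 1 := by
      rw [← map_ofNat C 2, ← map_mul]
      norm_num
    have hc : (0 : ℝ) ≤ |N| + 1 - (N + 4⁻¹) := by linarith [le_abs_self N]
    refine ⟨|N| + 1, by positivity, ?_, ?_⟩
    · have h2 := hM.add _ (hM.add _ hN0 _ (hM.sq (X i - C 2⁻¹))) _ (hM.real_mem hc)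
      convert h2 using 1
      simp only [algebraMap_eq, map_sub, map_add, map_one]
      linear_combination e + X i * e1
    · have h2 := hM.add _ (hM.add _ hN0 _ (hM.sq (X i + C 2⁻¹))) _ (hM.real_mem hc)
      convert h2 using 1
      simp only [algebraMap_eq, map_sub, map_add, map_one]
      linear_combination e - X i * e1
  intro p
  induction p using MvPolynomial.induction_on with
  | C c => exact hM.isBoundedMod_algebraMap c
  | add p q hp hq => exact hM.isBoundedMod_add hp hq
  | mul_X p i hp => exact hM.isBoundedMod_mul hp (hX i)

/-- Removing a denominator `1 + t` from a certificate of boundedness. The preordering generated by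
`T` and the ball is archimedean, which bounds `t`. -/
theorem ball_mem_of_mul_mem {T : Set (MvPolynomial (Fin n) ℝ)} (hT : IsCone T) {N : ℝ} (hN : 0 ≤ N)
    {s t : MvPolynomial (Fin n) ℝ} (hs : s ∈ T) (ht : t ∈ T)
    (h : (C N - ∑ i, X i ^ 2) * s = 1 + t) : ∃ N' : ℝ, C N' - ∑ i, X i ^ 2 ∈ T := by
  have hM := hT.isQuadraticModule
  set f : MvPolynomial (Fin n) ℝ := C N - ∑ i, X i ^ 2 with hf
  have hmul : ∀ z ∈ adjoinCone T f, (1 + t) * z ∈ T := by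
    rintro _ ⟨a, ha, b, hb, rfl⟩
    have e : (1 + t) * (a + f * b) = (1 + t) * a + f ^ 2 * (s * b) := by
      linear_combination (-(f * b)) * h
    rw [e]
    exact hT.add _ (hT.mul _ (hT.add _ hT.one _ ht) _ ha) _
      (hT.mul _ (hT.sq f) _ (hT.mul _ hs _ hb))
  obtain ⟨c, hc⟩ := isArchimedean_of_ball (hT.adjoin f).isQuadraticModule
    (hT.self_mem_adjoinCone f) t
  have ht2 : C (c + (2⁻¹ * c) ^ 2) - t ∈ T := by
    have h2 := hT.add _ (hmul _ hc) _ (hT.sq (C (2⁻¹ * c) - t))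
    convert h2 using 1
    have e : (2 : MvPolynomial (Fin n) ℝ) * C (2⁻¹ * c) = C c := by
      rw [← map_ofNat C 2, ← map_mul]
      congr 1
      ring
    rw [algebraMap_eq, map_add, map_pow]
    linear_combination t * e
  have hsum : ∑ i, (X i : MvPolynomial (Fin n) ℝ) ^ 2 ∈ T :=
    Finset.sum_induction _ (· ∈ T) (fun a b ha hb => hT.add a ha b hb) hT.zero fun j _ => hT.sq _
  have h3 := hmul f (hT.self_mem_adjoinCone f)
  have h4 := hT.add _ (hT.add _ h3 _ (hT.mul _ ht _ hsum)) _ (hM.real_mul hN ht2)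
  refine ⟨N + N * (c + (2⁻¹ * c) ^ 2), ?_⟩
  convert h4 using 1
  rw [map_add, map_mul, algebraMap_eq]
  simp only [hf]
  ring

/-- If the polynomial `u` is nonnegative only on a bounded set, then the preordering generated by
`u` contains the equation of a ball. -/
theorem exists_ball_mem_adjoinCone (u : MvPolynomial (Fin n) ℝ)
    (hu : IsCompact {x : Fin n → ℝ | 0 ≤ eval x u}) :
    ∃ N : ℝ, C N - ∑ i, X i ^ 2 ∈ adjoinCone {s | IsSumSq s} u := by
  classical
  obtain ⟨N, hN⟩ := hu.bddAbove_image (f := fun x : Fin n → ℝ => ∑ i, x i ^ 2)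
    (by fun_prop)
  set T := adjoinCone {s : MvPolynomial (Fin n) ℝ | IsSumSq s} u with hT
  have hTC : IsCone T := isCone_isSumSq.adjoin u
  set N₁ := max N 0 + 1 with hN₁
  set w : MvPolynomial (Fin n) ℝ := -(C N₁ - ∑ i, X i ^ 2) with hw
  have hneg : -1 ∈ adjoinCone T w := by
    by_contra hcon
    obtain ⟨b, hb⟩ := (hTC.adjoin w).exists_forall_eval_nonneg hcon {u, w} (by
      intro p hp
      rcases Finset.mem_insert.1 hp with rfl | hp
      · exact hTC.subset_adjoinCone w (isCone_isSumSq.self_mem_adjoinCone p)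
      · rw [Finset.mem_singleton.1 hp]
        exact hTC.self_mem_adjoinCone w)
    have h1 := hN (Set.mem_image_of_mem _ (hb u (by simp)))
    have h2 := hb w (by simp)
    simp only [hw, map_neg, map_sub, eval_C, map_sum, map_pow, eval_X] at h1 h2
    linarith [le_max_left N 0]
  obtain ⟨t, ht, s, hs, e⟩ := hneg
  refine ball_mem_of_mul_mem hTC (N := N₁) (by positivity) hs ht ?_
  rw [hw] at e
  linear_combination e

/-- The quadratic module generated by the polynomials `g j`. -/
def generatedModule {m : ℕ} (g : Fin m → MvPolynomial (Fin n) ℝ) :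
    Set (MvPolynomial (Fin n) ℝ) :=
  {f | ∃ (s₀ : MvPolynomial (Fin n) ℝ) (s : Fin m → MvPolynomial (Fin n) ℝ),
    IsSumSq s₀ ∧ (∀ j, IsSumSq (s j)) ∧ f = s₀ + ∑ j, g j * s j}

theorem isQuadraticModule_generatedModule {m : ℕ} (g : Fin m → MvPolynomial (Fin n) ℝ) :
    IsQuadraticModule (generatedModule g) where
  add := by
    rintro _ ⟨a, s, ha, hs, rfl⟩ _ ⟨b, t, hb, ht, rfl⟩
    refine ⟨a + b, fun j => s j + t j, ha.add hb, fun j => (hs j).add (ht j), ?_⟩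
    simp only [mul_add, Finset.sum_add_distrib]
    ring
  one := ⟨1, fun _ => 0, IsSumSq.one, fun _ => IsSumSq.zero, by simp⟩
  sq_mul := by
    rintro a _ ⟨b, s, hb, hs, rfl⟩
    have h := isCone_isSumSq.sq a
    refine ⟨a ^ 2 * b, fun j => a ^ 2 * s j, IsSumSq.mul h hb, fun j => IsSumSq.mul h (hs j), ?_⟩
    rw [mul_add, Finset.mul_sum]
    congr 1
    exact Finset.sum_congr rfl fun j _ => by ring

theorem self_mem_generatedModule {m : ℕ} (g : Fin m → MvPolynomial (Fin n) ℝ) (j : Fin m) :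
    g j ∈ generatedModule g := by
  classical
  refine ⟨0, fun i => if i = j then 1 else 0, IsSumSq.zero, fun i => ?_, by simp⟩
  dsimp only
  split_ifs
  · exact IsSumSq.one
  · exact IsSumSq.zero

/-- Putinar's Positivstellensatz. -/
theorem mem_generatedModule_of_pos {m : ℕ} (g : Fin m → MvPolynomial (Fin n) ℝ)
    (hK : PutinarAssumption g) (f : MvPolynomial (Fin n) ℝ)
    (hf : ∀ x ∈ feasibleSet g, 0 < eval x f) : f ∈ generatedModule g := by
  obtain ⟨-, u, u₀, v, hu₀, hv, hu, hcomp⟩ := hK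
  have hM := isQuadraticModule_generatedModule g
  have huM : u ∈ generatedModule g :=
    ⟨u₀, v, hu₀, hv, by rw [hu]; simp only [mul_comm]⟩
  obtain ⟨N, s, hs, t, ht, e⟩ := exists_ball_mem_adjoinCone u hcomp
  have hball : C N - ∑ i, X i ^ 2 ∈ generatedModule g := by
    rw [e, mul_comm]
    exact hM.add _ (hM.sumSq_mem hs) _ (hM.sumSq_mul ht huM)
  refine hM.mem_of_forall_character_pos (isArchimedean_of_ball hM hball) fun χ hχ => ?_
  have hχe : ∀ p, χ p = eval (fun i => χ (X i)) p := by
    intro p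
    have : χ = aeval fun i => χ (X i) := MvPolynomial.algHom_ext fun i => by simp
    conv_lhs => rw [this]
    exact DFunLike.congr_fun (MvPolynomial.coe_aeval_eq_eval _) p
  rw [hχe]
  refine hf _ fun j => ?_
  rw [← hχe]
  exact hχ _ (self_mem_generatedModule g j)

end PolynomialRing

/-! ### Invariant sesquilinear forms on irreducible representations -/

section InvariantForm

open Representation

variable {G : Type*} [Group G] [Fintype G] {V V' : Type*} [AddCommGroup V] [Module ℂ V]
  [AddCommGroup V'] [Module ℂ V']

theorem finiteDimensional_of_isIrreducible (τ : Representation ℂ G V) [hτ : IsIrreducible τ] :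
    FiniteDimensional ℂ V := by
  by_cases hV : ∀ v : V, v = 0
  · have : Subsingleton V := ⟨fun a b => (hV a).trans (hV b).symm⟩
    infer_instance
  push Not at hV
  obtain ⟨v, hv⟩ := hV
  let U : Subrepresentation τ :=
    { toSubmodule := Submodule.span ℂ (Set.range fun g => τ g v)
      apply_mem_toSubmodule := fun g w hw => by
        induction hw using Submodule.span_induction with
        | mem x hx =>
          obtain ⟨g', rfl⟩ := hx
          refine Submodule.subset_span ⟨g * g', ?_⟩
          simp
        | zero => simp
        | add x y _ _ hx hy => rw [map_add]; exact add_mem hx hy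
        | smul c x _ hx => rw [map_smul]; exact Submodule.smul_mem _ c hx }
  have hU : U = ⊤ := by
    refine (eq_bot_or_eq_top U).resolve_left fun h => hv ?_
    have h1 : v ∈ U.toSubmodule := Submodule.subset_span ⟨1, by simp⟩
    rw [h] at h1
    exact (Submodule.mem_bot ℂ).1 h1
  have hfin : FiniteDimensional ℂ U.toSubmodule :=
    FiniteDimensional.span_of_finite ℂ (Set.finite_range _)
  have htop : U.toSubmodule = ⊤ := by rw [hU]; rfl
  rw [htop] at hfin
  exact Module.finite_def.2 (Submodule.fg_top _ |>.1 (Module.finite_def.1 hfin))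

/-- The coordinates of the translates of a vector. They separate vectors, and the
form `∑ k, ℓ k v * conj (ℓ k w)` that they define is hermitian and invariant. -/
noncomputable def translateCoord (τ : Representation ℂ G V) [FiniteDimensional ℂ V]
    (k : G × Fin (Module.finrank ℂ V)) : V →ₗ[ℂ] ℂ :=
  (Module.finBasis ℂ V).coord k.2 ∘ₗ τ k.1

/-- An invariant positive definite hermitian form, linear in its second argument. -/
noncomputable def invariantForm (τ : Representation ℂ G V) [FiniteDimensional ℂ V] :
    V →ₛₗ[starRingEnd ℂ] V →ₗ[ℂ] ℂ :=
  LinearMap.mk₂'ₛₗ (starRingEnd ℂ) (RingHom.id ℂ)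
    (fun w v => ∑ k, translateCoord τ k v * starRingEnd ℂ (translateCoord τ k w))
    (fun _ _ _ => by simp only [map_add, mul_add, Finset.sum_add_distrib])
    (fun c w v => by
      simp only [map_smul, smul_eq_mul, map_mul, Finset.mul_sum]
      exact Finset.sum_congr rfl fun k _ => by ring)
    (fun _ _ _ => by simp only [map_add, add_mul, Finset.sum_add_distrib])
    (fun c w v => by
      simp only [map_smul, smul_eq_mul, RingHom.id_apply, Finset.mul_sum]
      exact Finset.sum_congr rfl fun k _ => by ring)

variable (τ : Representation ℂ G V) [FiniteDimensional ℂ V]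

theorem invariantForm_apply (w v : V) : invariantForm τ w v =
    ∑ k, translateCoord τ k v * starRingEnd ℂ (translateCoord τ k w) := rfl

theorem invariantForm_invariant (g : G) (w v : V) :
    invariantForm τ (τ g w) (τ g v) = invariantForm τ w v := by
  simp only [invariantForm_apply]
  refine Fintype.sum_equiv ((Equiv.mulRight g).prodCongr (Equiv.refl _)) _ _ fun k => ?_
  simp [translateCoord]

theorem invariantForm_self (v : V) :
    invariantForm τ v v = ((∑ k, Complex.normSq (translateCoord τ k v) : ℝ) : ℂ) := by
  rw [invariantForm_apply, Complex.ofReal_sum]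
  exact Finset.sum_congr rfl fun k _ => Complex.mul_conj _

theorem sum_normSq_translateCoord_pos {v : V} (hv : v ≠ 0) :
    0 < ∑ k, Complex.normSq (translateCoord τ k v) := by
  refine lt_of_le_of_ne (Finset.sum_nonneg fun k _ => Complex.normSq_nonneg _) fun h => hv ?_
  have h1 := (Finset.sum_eq_zero_iff_of_nonneg fun k _ => Complex.normSq_nonneg _).1 h.symm
  refine (Module.finBasis ℂ V).ext_elem fun i => ?_
  have h2 := Complex.normSq_eq_zero.1 (h1 (1, i) (Finset.mem_univ _))
  simpa [translateCoord] using h2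

theorem invariantForm_self_ne_zero {v : V} (hv : v ≠ 0) : invariantForm τ v v ≠ 0 := by
  rw [invariantForm_self]
  exact_mod_cast (sum_normSq_translateCoord_pos τ hv).ne'

theorem invariantForm_bijective : Function.Bijective (invariantForm τ) := by
  constructor
  · rw [injective_iff_map_eq_zero]
    intro w hw
    by_contra h0
    exact invariantForm_self_ne_zero τ h0 (by rw [hw]; rfl)
  · rw [← LinearMap.range_eq_top]
    by_contra hne
    obtain ⟨f, hf, hle⟩ := Submodule.exists_le_ker_of_lt_top _ (lt_top_iff_ne_top.2 hne)
    -- A functional on the dual space vanishing on the range is evaluation at a vector.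
    obtain ⟨v, rfl⟩ := (Module.evalEquiv ℂ V).surjective f
    have hv : invariantForm τ v v = 0 := hle ⟨v, rfl⟩
    by_cases h0 : v = 0
    · exact hf (by rw [h0, map_zero])
    · exact invariantForm_self_ne_zero τ h0 hv

/-- An invariant sesquilinear form between two representations is induced by an intertwining
map. -/
theorem exists_intertwiningMap_of_form (τ' : Representation ℂ G V')
    (B : V' →ₛₗ[starRingEnd ℂ] V →ₗ[ℂ] ℂ) (hB : ∀ g w v, B (τ' g w) (τ g v) = B w v) :
    ∃ T : IntertwiningMap τ' τ, ∀ w v, B w v = invariantForm τ (T w) v := by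
  let e := LinearEquiv.ofBijective (invariantForm τ) (invariantForm_bijective τ)
  have he : ∀ w, invariantForm τ (e.symm (B w)) = B w := fun w => e.apply_symm_apply (B w)
  let T : V' →ₗ[ℂ] V := e.symm.toLinearMap.comp B
  have hT : ∀ w v, B w v = invariantForm τ (T w) v := fun w v => by
    rw [← he w]
    rfl
  refine ⟨LinearMap.intertwiningMap_of_isIntertwiningMap τ' τ T fun g w => ?_, hT⟩
  refine (invariantForm_bijective τ).1 (LinearMap.ext fun v => ?_)
  have hv : v = τ g (τ g⁻¹ v) := by simp
  rw [← hT, hv, hB, hT, invariantForm_invariant]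

theorem form_eq_zero_of_not_equiv {τ : Representation ℂ G V} {τ' : Representation ℂ G V'}
    [IsIrreducible τ] [IsIrreducible τ'] (h : IsEmpty (τ'.Equiv τ))
    (B : V' →ₛₗ[starRingEnd ℂ] V →ₗ[ℂ] ℂ) (hB : ∀ g w v, B (τ' g w) (τ g v) = B w v) (w : V')
    (v : V) : B w v = 0 := by
  obtain ⟨T, hT⟩ := exists_intertwiningMap_of_form τ τ' B hB
  rw [hT, Subsingleton.elim T 0]
  simp

/-- An invariant sesquilinear form on an irreducible representation is proportional to the
invariant hermitian form; the factor is read off at any vector `s`. -/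
theorem form_mul_invariantForm [IsIrreducible τ] (B : V →ₛₗ[starRingEnd ℂ] V →ₗ[ℂ] ℂ)
    (hB : ∀ g w v, B (τ g w) (τ g v) = B w v) (s w v : V) :
    B w v * invariantForm τ s s = B s s * invariantForm τ w v := by
  obtain ⟨T, hT⟩ := exists_intertwiningMap_of_form τ τ B hB
  obtain ⟨c, rfl⟩ := (IsIrreducible.algebraMap_intertwiningMap_bijective_of_isAlgClosed
    (ρ := τ)).2 T
  have hc : ∀ w v, B w v = starRingEnd ℂ c * invariantForm τ w v := by
    intro w v
    rw [hT]
    have : (algebraMap ℂ (IntertwiningMap τ τ) c) w = c • w := rfl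
    rw [this, map_smulₛₗ]
    rfl
  rw [hc, hc]
  ring

end InvariantForm

/-! ### Averaging hermitian squares of complex polynomials -/

section TranslateSum

/-- Coefficientwise complex conjugation. -/
noncomputable def conjPoly {n : ℕ} : MvPolynomial (Fin n) ℂ →+* MvPolynomial (Fin n) ℂ :=
  map (starRingEnd ℂ)

/-- A real polynomial regarded as a complex one. -/
noncomputable def ofRealPoly {n : ℕ} : MvPolynomial (Fin n) ℝ →+* MvPolynomial (Fin n) ℂ :=
  map (algebraMap ℝ ℂ)

theorem map_linSubst {n : ℕ} {k k' : Type*} [CommRing k] [CommRing k'] (φ : k →+* k')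
    (A : Matrix (Fin n) (Fin n) k) (p : MvPolynomial (Fin n) k) :
    map φ (linSubst A p) = linSubst (A.map φ) (map φ p) := by
  have h : (map φ).comp (linSubst A : MvPolynomial (Fin n) k →+* MvPolynomial (Fin n) k) =
      (linSubst (A.map φ) : MvPolynomial (Fin n) k' →+* MvPolynomial (Fin n) k').comp (map φ) := by
    refine MvPolynomial.ringHom_ext (fun c => ?_) fun i => ?_
    · simp [linSubst]
    · simp [linSubst]
  exact DFunLike.congr_fun h p

variable {G : Type*} [Group G] {n : ℕ} (ρ : Representation ℝ G (Fin n → ℝ))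

theorem polyRep_mul {k : Type*} [CommRing k] [Algebra ℝ k] (g : G) (p q : MvPolynomial (Fin n) k) :
    polyRep k ρ g (p * q) = polyRep k ρ g p * polyRep k ρ g q :=
  map_mul (linSubst _) p q

theorem polyRep_conjPoly (g : G) (p : MvPolynomial (Fin n) ℂ) :
    polyRep ℂ ρ g (conjPoly p) = conjPoly (polyRep ℂ ρ g p) := by
  refine Eq.trans ?_ (map_linSubst (starRingEnd ℂ)
    ((LinearMap.toMatrix' (ρ g⁻¹)).map (algebraMap ℝ ℂ)) p).symm
  have : ((LinearMap.toMatrix' (ρ g⁻¹)).map (algebraMap ℝ ℂ)).map (starRingEnd ℂ) =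
      (LinearMap.toMatrix' (ρ g⁻¹)).map (algebraMap ℝ ℂ) := by
    ext i j
    simp
  rw [this]
  rfl

theorem polyRep_ofRealPoly (g : G) (p : MvPolynomial (Fin n) ℝ) :
    polyRep ℂ ρ g (ofRealPoly p) = ofRealPoly (polyRep ℝ ρ g p) :=
  (map_linSubst (algebraMap ℝ ℂ) ((LinearMap.toMatrix' (ρ g⁻¹)).map (algebraMap ℝ ℝ)) p).symm

theorem ofRealPoly_injective {n : ℕ} : Function.Injective (ofRealPoly (n := n)) :=
  map_injective _ (algebraMap ℝ ℂ).injective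

theorem conjPoly_smul {n : ℕ} (c : ℂ) (p : MvPolynomial (Fin n) ℂ) :
    conjPoly (c • p) = starRingEnd ℂ c • conjPoly p := by
  ext d
  simp [conjPoly, coeff_map]

theorem ofRealPoly_rePart_add {n : ℕ} (p : MvPolynomial (Fin n) ℂ) :
    ofRealPoly (rePart p) + C Complex.I * ofRealPoly (imPart p) = p := by
  ext d
  simp only [ofRealPoly, coeff_add, coeff_C_mul, coeff_map, coeff_rePart, coeff_imPart]
  rw [mul_comm]
  exact Complex.re_add_im _

theorem conjPoly_ofRealPoly {n : ℕ} (p : MvPolynomial (Fin n) ℝ) :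
    conjPoly (ofRealPoly p) = ofRealPoly p := by
  ext d
  simp [conjPoly, ofRealPoly, coeff_map]

theorem mul_conjPoly_self {n : ℕ} (p : MvPolynomial (Fin n) ℂ) :
    p * conjPoly p = ofRealPoly (rePart p ^ 2 + imPart p ^ 2) := by
  have hp := ofRealPoly_rePart_add p
  generalize rePart p = a at hp ⊢
  generalize imPart p = b at hp ⊢
  subst hp
  have hc : conjPoly (C Complex.I : MvPolynomial (Fin n) ℂ) = -C Complex.I := by
    simp [conjPoly]
  have hI : (C Complex.I : MvPolynomial (Fin n) ℂ) ^ 2 = -1 := by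
    rw [← map_pow, Complex.I_sq, map_neg, map_one]
  simp only [map_add, map_mul, map_pow, conjPoly_ofRealPoly, hc]
  linear_combination (-ofRealPoly b ^ 2) * hI

variable [Fintype G]

/-- The sum over the group of the translates of `p * conj q`, as a sesquilinear form with
polynomial values, linear in its second argument `p`. -/
noncomputable def translateSumForm :
    MvPolynomial (Fin n) ℂ →ₛₗ[starRingEnd ℂ] MvPolynomial (Fin n) ℂ →ₗ[ℂ]
      MvPolynomial (Fin n) ℂ :=
  LinearMap.mk₂'ₛₗ (starRingEnd ℂ) (RingHom.id ℂ)
    (fun q p => ∑ g, polyRep ℂ ρ g (p * conjPoly q))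
    (fun _ _ _ => by simp only [map_add, mul_add, Finset.sum_add_distrib])
    (fun c q p => by
      simp only [conjPoly_smul, mul_smul_comm, map_smul, Finset.smul_sum])
    (fun _ _ _ => by simp only [map_add, add_mul, Finset.sum_add_distrib])
    (fun c q p => by
      simp only [smul_mul_assoc, map_smul, Finset.smul_sum, RingHom.id_apply])

theorem translateSumForm_apply (q p : MvPolynomial (Fin n) ℂ) :
    translateSumForm ρ q p = ∑ g, polyRep ℂ ρ g (p * conjPoly q) := rfl

theorem translateSumForm_invariant (g : G) (q p : MvPolynomial (Fin n) ℂ) :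
    translateSumForm ρ (polyRep ℂ ρ g q) (polyRep ℂ ρ g p) = translateSumForm ρ q p := by
  simp only [translateSumForm_apply, ← polyRep_conjPoly, ← polyRep_mul]
  refine Fintype.sum_equiv (Equiv.mulRight g) _ _ fun k => ?_
  simp

theorem translateSumForm_self (p : MvPolynomial (Fin n) ℂ) :
    translateSumForm ρ p p =
      ofRealPoly (∑ g, polyRep ℝ ρ g (rePart p ^ 2 + imPart p ^ 2)) := by
  simp only [translateSumForm_apply, mul_conjPoly_self, polyRep_ofRealPoly, map_sum]

end TranslateSum

/-! ### Sums of squares from a symmetry adapted basis -/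

section SpanSquares

variable {n : ℕ} {S : Set (MvPolynomial (Fin n) ℝ)}

theorem isSumSqOfSpan_zero : IsSumSqOfSpan S 0 :=
  ⟨0, Fin.elim0, fun k => k.elim0, by simp⟩

theorem IsSumSqOfSpan.add {q q' : MvPolynomial (Fin n) ℝ} (h : IsSumSqOfSpan S q)
    (h' : IsSumSqOfSpan S q') : IsSumSqOfSpan S (q + q') := by
  obtain ⟨N, p, hp, rfl⟩ := h
  obtain ⟨N', p', hp', rfl⟩ := h'
  refine ⟨N + N', Fin.append p p', fun k => ?_, by simp [Fin.sum_univ_add]⟩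
  refine Fin.addCases (fun k => ?_) (fun k => ?_) k
  · simpa using hp k
  · simpa using hp' k

theorem isSumSqOfSpan_sq {p : MvPolynomial (Fin n) ℝ} (hp : p ∈ Submodule.span ℝ S) :
    IsSumSqOfSpan S (p ^ 2) :=
  ⟨1, fun _ => p, fun _ => hp, by simp⟩

theorem isSumSqOfSpan_sum {ι : Type*} (s : Finset ι) {q : ι → MvPolynomial (Fin n) ℝ}
    (hq : ∀ k, IsSumSqOfSpan S (q k)) : IsSumSqOfSpan S (∑ k ∈ s, q k) :=
  Finset.sum_induction q (IsSumSqOfSpan S) (fun _ _ => IsSumSqOfSpan.add) isSumSqOfSpan_zero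
    fun k _ => hq k

theorem re_im_mem_span {S : Set (MvPolynomial (Fin n) ℂ)} {t : MvPolynomial (Fin n) ℂ}
    (ht : t ∈ Submodule.span ℂ S) :
    rePart t ∈ Submodule.span ℝ (rePart '' S ∪ imPart '' S) ∧
      imPart t ∈ Submodule.span ℝ (rePart '' S ∪ imPart '' S) := by
  induction ht using Submodule.span_induction with
  | mem x hx =>
    exact ⟨Submodule.subset_span (Or.inl ⟨x, hx, rfl⟩),
      Submodule.subset_span (Or.inr ⟨x, hx, rfl⟩)⟩
  | zero => simp [rePart, imPart]
  | add x y _ _ hx hy =>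
    have h1 : rePart (x + y) = rePart x + rePart y := by ext d; simp [coeff_rePart]
    have h2 : imPart (x + y) = imPart x + imPart y := by ext d; simp [coeff_imPart]
    rw [h1, h2]
    exact ⟨add_mem hx.1 hy.1, add_mem hx.2 hy.2⟩
  | smul c x _ hx =>
    have h1 : rePart (c • x) = c.re • rePart x - c.im • imPart x := by
      ext d; simp [coeff_rePart, coeff_imPart]
    have h2 : imPart (c • x) = c.re • imPart x + c.im • rePart x := by
      ext d; simp [coeff_rePart, coeff_imPart]
    rw [h1, h2]
    exact ⟨sub_mem (Submodule.smul_mem _ _ hx.1) (Submodule.smul_mem _ _ hx.2),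
      add_mem (Submodule.smul_mem _ _ hx.2) (Submodule.smul_mem _ _ hx.1)⟩

end SpanSquares

namespace SymmetryAdaptedBasis

open Representation

variable {G : Type*} [Group G] {n h : ℕ} {ρ : Representation ℝ G (Fin n → ℝ)}
  {J : Fin h → Type*} (B : SymmetryAdaptedBasis ρ h J)

/-- The irreducible representation of type `i` from which the isomorphisms `φ i j` start. -/
noncomputable abbrev baseRep (i : Fin h) : Representation ℂ G (B.W i (B.base i)).toSubmodule :=
  (B.W i (B.base i)).toRepresentation

/-- The isomorphism `φ i j` as an embedding into the polynomial ring. -/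
noncomputable def embed (i : Fin h) (j : J i) :
    (B.W i (B.base i)).toSubmodule →ₗ[ℂ] MvPolynomial (Fin n) ℂ :=
  (B.W i j).toSubmodule.subtype ∘ₗ (B.φ i j).toLinearEquiv.toLinearMap

theorem embed_baseRep (i : Fin h) (j : J i) (g : G) (v : (B.W i (B.base i)).toSubmodule) :
    B.embed i j (B.baseRep i g v) = polyRep ℂ ρ g (B.embed i j v) :=
  congrArg Subtype.val (LinearMap.congr_fun ((B.φ i j).toIntertwiningMap.isIntertwining' g) v)

theorem embed_s_mem (i : Fin h) (j : J i) : B.embed i j (B.s i) ∈ B.complexSet i :=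
  ⟨j, rfl⟩

/-- The polynomial `∑ j, φ i j (w j)` of the `i`-th isotypic component. -/
noncomputable def component (i : Fin h) :
    (J i →₀ (B.W i (B.base i)).toSubmodule) →ₗ[ℂ] MvPolynomial (Fin n) ℂ :=
  Finsupp.lsum ℂ (B.embed i)

theorem component_apply (i : Fin h) (w : J i →₀ (B.W i (B.base i)).toSubmodule) :
    B.component i w = ∑ j ∈ w.support, B.embed i j (w j) := rfl

theorem exists_eq_sum_component (p : MvPolynomial (Fin n) ℂ) :
    ∃ w : ∀ i, J i →₀ (B.W i (B.base i)).toSubmodule, p = ∑ i, B.component i (w i) := by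
  classical
  have hp : p ∈ ⨆ a : (Σ i, J i), (B.W a.1 a.2).toSubmodule := by
    rw [B.spans]
    trivial
  induction hp using Submodule.iSup_induction' with
  | mem a x hx =>
    obtain ⟨i, j⟩ := a
    refine ⟨Pi.single i (Finsupp.single j ((B.φ i j).symm ⟨x, hx⟩)), ?_⟩
    rw [Finset.sum_eq_single i (fun i' _ hi => by rw [Pi.single_eq_of_ne hi, map_zero])
      (fun hi => absurd (Finset.mem_univ i) hi), Pi.single_eq_same, component,
      Finsupp.lsum_single]
    exact (congrArg Subtype.val ((B.φ i j).apply_symm_apply ⟨x, hx⟩)).symm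
  | zero => exact ⟨0, by simp⟩
  | add x y _ _ hx hy =>
    obtain ⟨w, rfl⟩ := hx
    obtain ⟨w', rfl⟩ := hy
    exact ⟨w + w', by simp [Finset.sum_add_distrib]⟩

variable [Fintype G]

/-- A coefficient of the averaged product of the embedded vectors, as a sesquilinear form on the
irreducible representations. -/
noncomputable def coeffForm (d : Fin n →₀ ℕ) (i' : Fin h) (j' : J i') (i : Fin h) (j : J i) :
    (B.W i' (B.base i')).toSubmodule →ₛₗ[starRingEnd ℂ] (B.W i (B.base i)).toSubmodule →ₗ[ℂ] ℂ :=
  LinearMap.mk₂'ₛₗ (starRingEnd ℂ) (RingHom.id ℂ)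
    (fun w v => coeff d (translateSumForm ρ (B.embed i' j' w) (B.embed i j v)))
    (fun _ _ _ => by simp)
    (fun c w v => by simp)
    (fun _ _ _ => by simp)
    (fun c w v => by simp)

theorem coeffForm_invariant (d : Fin n →₀ ℕ) (i' : Fin h) (j' : J i') (i : Fin h) (j : J i)
    (g : G) (w : (B.W i' (B.base i')).toSubmodule) (v : (B.W i (B.base i)).toSubmodule) :
    B.coeffForm d i' j' i j (B.baseRep i' g w) (B.baseRep i g v) =
      B.coeffForm d i' j' i j w v := by
  change coeff d (translateSumForm ρ (B.embed i' j' _) (B.embed i j _)) = _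
  rw [embed_baseRep, embed_baseRep, translateSumForm_invariant]
  rfl

instance isIrreducible_baseRep (i : Fin h) : IsIrreducible (B.baseRep i) :=
  B.irreducible i (B.base i)

instance finiteDimensional_base (i : Fin h) :
    FiniteDimensional ℂ (B.W i (B.base i)).toSubmodule :=
  finiteDimensional_of_isIrreducible (B.baseRep i)

theorem translateSumForm_embed_of_ne {i' i : Fin h} (hi : i' ≠ i) (j' : J i') (j : J i)
    (w : (B.W i' (B.base i')).toSubmodule) (v : (B.W i (B.base i)).toSubmodule) :
    translateSumForm ρ (B.embed i' j' w) (B.embed i j v) = 0 := by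
  ext d
  exact form_eq_zero_of_not_equiv (B.not_iso i' i _ _ hi) (B.coeffForm d i' j' i j)
    (B.coeffForm_invariant d i' j' i j) w v

theorem translateSumForm_component_of_ne {i' i : Fin h} (hi : i' ≠ i)
    (w : J i' →₀ (B.W i' (B.base i')).toSubmodule) (v : J i →₀ (B.W i (B.base i)).toSubmodule) :
    translateSumForm ρ (B.component i' w) (B.component i v) = 0 := by
  simp only [component_apply, map_sum, LinearMap.sum_apply, B.translateSumForm_embed_of_ne hi,
    Finset.sum_const_zero]

theorem translateSumForm_embed (i : Fin h) (j' j : J i)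
    (w v : (B.W i (B.base i)).toSubmodule) :
    invariantForm (B.baseRep i) (B.s i) (B.s i) •
        translateSumForm ρ (B.embed i j' w) (B.embed i j v) =
      invariantForm (B.baseRep i) w v •
        translateSumForm ρ (B.embed i j' (B.s i)) (B.embed i j (B.s i)) := by
  ext d
  have h1 := form_mul_invariantForm (B.baseRep i) (B.coeffForm d i j' i j)
    (B.coeffForm_invariant d i j' i j) (B.s i) w v
  rw [coeff_smul, coeff_smul, smul_eq_mul, smul_eq_mul, mul_comm]
  exact h1.trans (mul_comm _ _)

/-- In an isotypic component, averaging a hermitian square gives the same as averaging a sum of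
hermitian squares of combinations of the `φ i j (s i)`: the vectors `w j` enter the average only
through the invariant form, which is a sum of hermitian squares of linear forms. -/
theorem exists_translateSumForm_component_self (i : Fin h)
    (w : J i →₀ (B.W i (B.base i)).toSubmodule) :
    ∃ t : G × Fin (Module.finrank ℂ (B.W i (B.base i)).toSubmodule) → MvPolynomial (Fin n) ℂ,
      (∀ k, t k ∈ Submodule.span ℂ (B.complexSet i)) ∧
      translateSumForm ρ (B.component i w) (B.component i w) =
        ∑ k, translateSumForm ρ (t k) (t k) := by
  have hr := sum_normSq_translateCoord_pos (B.baseRep i) (B.s_ne_zero i)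
  have hH := invariantForm_self (B.baseRep i) (B.s i)
  set r : ℝ := ∑ k, Complex.normSq (translateCoord (B.baseRep i) k (B.s i)) with hr_def
  -- The factor `c` divides the hermitian squares by the value `r` of the invariant form at `s i`.
  let c : ℂ := ((Real.sqrt r)⁻¹ : ℝ)
  have hc : (r : ℂ) * (c * starRingEnd ℂ c) = 1 := by
    rw [Complex.conj_ofReal, ← Complex.ofReal_mul, ← Complex.ofReal_mul, ← mul_inv,
      Real.mul_self_sqrt hr.le, mul_inv_cancel₀ hr.ne', Complex.ofReal_one]
  refine ⟨fun k => c • ∑ j ∈ w.support,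
    translateCoord (B.baseRep i) k (w j) • B.embed i j (B.s i), fun k => ?_, ?_⟩
  · exact Submodule.smul_mem _ _ (Submodule.sum_mem _ fun j _ =>
      Submodule.smul_mem _ _ (Submodule.subset_span (B.embed_s_mem i j)))
  refine smul_right_injective _ (Complex.ofReal_ne_zero.2 hr.ne') ?_
  change (r : ℂ) • _ = (r : ℂ) • _
  simp only [component_apply, map_sum, LinearMap.sum_apply, map_smulₛₗ, LinearMap.smul_apply,
    Finset.smul_sum, smul_smul, RingHom.id_apply]
  rw [Finset.sum_comm' (s := Finset.univ) (t := fun _ => w.support) (t' := w.support)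
    (s' := fun _ => Finset.univ) (by simp)]
  refine Finset.sum_congr rfl fun j _ => ?_
  rw [Finset.sum_comm]
  refine Finset.sum_congr rfl fun j' _ => ?_
  rw [← hH, B.translateSumForm_embed, invariantForm_apply, Finset.sum_smul]
  refine Finset.sum_congr rfl fun k _ => ?_
  congr 1
  rw [hH, map_mul]
  linear_combination (-(translateCoord (B.baseRep i) k (w j)) *
    starRingEnd ℂ (translateCoord (B.baseRep i) k (w j'))) * hc

/-- Averaging the square of a polynomial gives the same as averaging a sum of squares taken from
the spans of the sets `𝒮ⁱ`. -/
theorem exists_reynolds_sq (p : MvPolynomial (Fin n) ℝ) :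
    ∃ q : Fin h → MvPolynomial (Fin n) ℝ, (∀ i, IsSumSqOfSpan (B.realSet i) (q i)) ∧
      reynolds ρ (p ^ 2) = reynolds ρ (∑ i, q i) := by
  obtain ⟨w, hw⟩ := B.exists_eq_sum_component (ofRealPoly p)
  choose t ht hT using fun i => B.exists_translateSumForm_component_self i (w i)
  refine ⟨fun i => ∑ k, (rePart (t i k) ^ 2 + imPart (t i k) ^ 2), fun i => ?_, ?_⟩
  · exact isSumSqOfSpan_sum _ fun k => (isSumSqOfSpan_sq (re_im_mem_span (ht i k)).1).add
      (isSumSqOfSpan_sq (re_im_mem_span (ht i k)).2)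
  have h1 : translateSumForm ρ (ofRealPoly p) (ofRealPoly p) =
      ofRealPoly (∑ g, polyRep ℝ ρ g (p ^ 2)) := by
    simp only [translateSumForm_apply, conjPoly_ofRealPoly, ← sq, ← map_pow, polyRep_ofRealPoly,
      map_sum]
  have h2 : translateSumForm ρ (ofRealPoly p) (ofRealPoly p) =
      ∑ i, ∑ k, translateSumForm ρ (t i k) (t i k) := by
    rw [hw]
    simp only [map_sum, LinearMap.sum_apply]
    refine Finset.sum_congr rfl fun i _ => ?_
    rw [Finset.sum_eq_single i (fun i' _ hi => B.translateSumForm_component_of_ne hi _ _)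
      (fun hi => absurd (Finset.mem_univ i) hi), hT]
  rw [h1] at h2
  simp only [translateSumForm_self, ← map_sum] at h2
  have h3 := ofRealPoly_injective h2
  rw [reynolds, reynolds, h3]
  congr 1
  rw [Finset.sum_congr rfl fun i _ => Finset.sum_comm, Finset.sum_comm]
  simp only [map_sum]

end SymmetryAdaptedBasis

/-! ### The Reynolds operator -/

section Reynolds

variable {G : Type*} [Group G] [Fintype G] {n : ℕ} (ρ : Representation ℝ G (Fin n → ℝ))

theorem reynolds_add (p q : MvPolynomial (Fin n) ℝ) :
    reynolds ρ (p + q) = reynolds ρ p + reynolds ρ q := by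
  simp [reynolds, Finset.sum_add_distrib]

theorem reynolds_sum {ι : Type*} (s : Finset ι) (p : ι → MvPolynomial (Fin n) ℝ) :
    reynolds ρ (∑ i ∈ s, p i) = ∑ i ∈ s, reynolds ρ (p i) := by
  simp only [reynolds, map_sum, ← Finset.smul_sum]
  rw [Finset.sum_comm]

theorem reynolds_invariant_mul {g : MvPolynomial (Fin n) ℝ} (hg : IsInvariantPoly ρ g)
    (p : MvPolynomial (Fin n) ℝ) : reynolds ρ (g * p) = g * reynolds ρ p := by
  simp only [reynolds, polyRep_mul, hg _, ← Finset.mul_sum, mul_smul_comm]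

theorem reynolds_of_isInvariantPoly {f : MvPolynomial (Fin n) ℝ} (hf : IsInvariantPoly ρ f) :
    reynolds ρ f = f := by
  simp only [reynolds, hf _, Finset.sum_const, Finset.card_univ]
  rw [← Nat.cast_smul_eq_nsmul ℝ, smul_smul, inv_mul_cancel₀, one_smul]
  exact_mod_cast Fintype.card_ne_zero

variable {ρ}

theorem SymmetryAdaptedBasis.exists_reynolds_isSumSq {h : ℕ} {J : Fin h → Type*}
    (B : SymmetryAdaptedBasis ρ h J) {p : MvPolynomial (Fin n) ℝ} (hp : IsSumSq p) :
    ∃ q : Fin h → MvPolynomial (Fin n) ℝ, (∀ i, IsSumSqOfSpan (B.realSet i) (q i)) ∧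
      reynolds ρ p = reynolds ρ (∑ i, q i) := by
  induction hp with
  | zero => exact ⟨0, fun i => isSumSqOfSpan_zero, by simp⟩
  | sq_add a _ ih =>
    obtain ⟨q, hq, h⟩ := B.exists_reynolds_sq a
    obtain ⟨q', hq', h'⟩ := ih
    refine ⟨q + q', fun i => (hq i).add (hq' i), ?_⟩
    simp only [Pi.add_apply, Finset.sum_add_distrib]
    rw [reynolds_add, reynolds_add, ← sq, h, h']

end Reynolds

theorem mainTheorem3 {G : Type*} [Group G] [Fintype G] {n m h : ℕ}
    (ρ : Representation ℝ G (Fin n → ℝ)) {J : Fin h → Type*}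
    (B : SymmetryAdaptedBasis ρ h J)
    (f : MvPolynomial (Fin n) ℝ) (g : Fin m → MvPolynomial (Fin n) ℝ)
    (hf : IsInvariantPoly ρ f) (hg : ∀ j, IsInvariantPoly ρ (g j))
    (hK : PutinarAssumption g)
    (hpos : ∀ x ∈ feasibleSet g, 0 < MvPolynomial.eval x f) :
    ∃ (q₀ : Fin h → MvPolynomial (Fin n) ℝ) (q : Fin m → Fin h → MvPolynomial (Fin n) ℝ),
      (∀ i, IsSumSqOfSpan (B.realSet i) (q₀ i)) ∧
      (∀ j i, IsSumSqOfSpan (B.realSet i) (q j i)) ∧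
      f = reynolds ρ ((∑ i, q₀ i) + ∑ j, g j * (∑ i, q j i)) := by
  obtain ⟨s₀, s, hs₀, hs, hfs⟩ := mem_generatedModule_of_pos g hK f hpos
  obtain ⟨q₀, hq₀, h₀⟩ := B.exists_reynolds_isSumSq hs₀
  choose q hq hr using fun j => B.exists_reynolds_isSumSq (hs j)
  refine ⟨q₀, q, hq₀, hq, ?_⟩
  rw [← reynolds_of_isInvariantPoly ρ hf, hfs]
  simp only [reynolds_add, reynolds_sum ρ Finset.univ, reynolds_invariant_mul ρ (hg _), hr]
  simp only [h₀, reynolds_sum ρ Finset.univ]
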